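/- Let $S$ be a compact connected oriented surface with (possibly empty) boundary and $\chi(S)<0$. Fix a hyperbolic metric $h$ on $S$ (curvature $-1$, geodesic boundary), let $\tilde S\to S$ be the universal cover with the lifted metric and deck group $\pi=\pi_1(S)$, and identify $\tilde S$ isometrically, preserving orientation, with a subset of the hyperbolic plane $\mathbb D^2$. Let $\partial_\infty\tilde S$ be the set of points of the circle $\partial\mathbb D^2$ that lie in the closure of $\tilde S$. For $y_1,y_2\in\partial_\infty\tilde S$ let $[y_1,y_2]_\infty$ be the set of points of $\partial_\infty\tilde S$ that are equal to $y_1$ or $y_2$, or are met when travelling along the circle from $y_1$ to $y_2\neq y_1$ in the positive direction, and let $(y_1,y_2)_\infty=[y_1,y_2]_\infty\setminus\{y_1,y_2\}$. Let $\mathcal G(\tilde S)$ be the space of unordered pairs of distinct points of $\partial_\infty\tilde S$; the pair $\{x,y\}$ represents the geodesic of $\tilde S$ with endpoints $x$ and $y$. A geodesic current on $S$ is a $\pi$-invariant, locally finite Borel measure on $\mathcal G(\tilde S)$. \textbf{Lemma (Geodesics constrained inside a spike have measure zero).}\label{lemma:spike} Let $x,y_1,y_2\in\partial_\infty\tilde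 S$ with $x\notin[y_1,y_2]_\infty$. Suppose that for every $y\in[y_1,y_2]_\infty$ the projection to $S$ of the geodesic $\{x,y\}\in\mathcal G(\tilde S)$ is not a closed geodesic. Then every geodesic current $c$ on $S$ satisfies $$c\bigl(\{\{x,y\} : y\in(y_1,y_2)_\infty\}\bigr)=0 .$$ -/

import Mathlib

open Set Filter Topology MeasureTheory
open scoped UpperHalfPlane MatrixGroups OnePoint

noncomputable section

/-! ### The circle at infinity of the hyperbolic plane -/

namespace HypPlane

/-- The circle at infinity of the hyperbolic plane `ℍ` is `OnePoint ℝ`; both `ℍ` and its circle at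
infinity sit in the Riemann sphere `OnePoint ℂ`. This is the inclusion of the plane. -/
def toSphere (z : ℍ) : OnePoint ℂ := ((z : ℂ) : OnePoint ℂ)

/-- The inclusion of the circle at infinity in the Riemann sphere. -/
def bdryToSphere (x : OnePoint ℝ) : OnePoint ℂ := OnePoint.map (algebraMap ℝ ℂ) x

/-- Homogeneous coordinates on the Riemann sphere. -/
def homog (v : ℂ × ℂ) : OnePoint ℂ := if v.2 = 0 then ∞ else ((v.1 / v.2 : ℂ) : OnePoint ℂ)

theorem continuousAt_homog (v : ℂ × ℂ) (hv : v ≠ 0) : ContinuousAt homog v := by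
  by_cases h2 : v.2 = 0
  · have h1 : v.1 ≠ 0 := fun h1 => hv (Prod.ext h1 h2)
    have hval : homog v = ∞ := by simp [homog, h2]
    rw [ContinuousAt, hval, OnePoint.nhds_infty_eq]
    have key : Tendsto (fun w : ℂ × ℂ => w.1 / w.2) (𝓝 v ⊓ 𝓟 {w | w.2 ≠ 0})
        (coclosedCompact ℂ) := by
      rw [coclosedCompact_eq_cocompact, ← Metric.cobounded_eq_cocompact]
      rw [← tendsto_norm_atTop_iff_cobounded]
      have ha : Tendsto (fun w : ℂ × ℂ => ‖w.1‖) (𝓝 v ⊓ 𝓟 {w | w.2 ≠ 0}) (𝓝 ‖v.1‖) :=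
        ((continuous_fst.norm.tendsto v)).mono_left inf_le_left
      have hb0 : Tendsto (fun w : ℂ × ℂ => ‖w.2‖) (𝓝 v ⊓ 𝓟 {w | w.2 ≠ 0}) (𝓝[>] 0) := by
        refine tendsto_nhdsWithin_iff.2 ⟨?_, ?_⟩
        · have := (continuous_snd.norm.tendsto v).mono_left
            (inf_le_left : 𝓝 v ⊓ 𝓟 {w : ℂ × ℂ | w.2 ≠ 0} ≤ 𝓝 v)
          simpa [h2] using this
        · have : ∀ᶠ w in (𝓝 v ⊓ 𝓟 {w : ℂ × ℂ | w.2 ≠ 0}), w.2 ≠ 0 :=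
            (eventually_principal.2 fun w hw => hw).filter_mono inf_le_right
          filter_upwards [this] with w hw
          exact norm_pos_iff.2 hw
      have hb := hb0.inv_tendsto_nhdsGT_zero
      have := ha.pos_mul_atTop (norm_pos_iff.2 h1) hb
      refine this.congr fun w => ?_
      simp [div_eq_mul_inv]
    intro s hs
    rw [mem_sup, mem_map, mem_pure] at hs
    have h := key hs.1
    rw [mem_map, mem_inf_principal] at h
    rw [mem_map]
    filter_upwards [h] with w hw
    by_cases hw2 : w.2 = 0
    · simpa [homog, hw2] using hs.2
    · simpa [homog, hw2] using hw hw2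
  · have hev : ∀ᶠ w : ℂ × ℂ in 𝓝 v, w.2 ≠ 0 :=
      continuous_snd.continuousAt.eventually_ne h2
    have hc : ContinuousAt (fun w : ℂ × ℂ => ((w.1 / w.2 : ℂ) : OnePoint ℂ)) v :=
      OnePoint.continuous_coe.continuousAt.comp
        (continuous_fst.continuousAt.div continuous_snd.continuousAt h2)
    refine hc.congr ?_
    filter_upwards [hev] with w hw
    simp [homog, hw]

/-- Möbius transformations are continuous on the Riemann sphere. -/
theorem continuous_smul_sphere (g : GL (Fin 2) ℂ) :
    Continuous (fun p : OnePoint ℂ => g • p) := by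
  have hdet : g 0 0 * g 1 1 - g 0 1 * g 1 0 ≠ 0 := by
    have := g.det_ne_zero
    rwa [Matrix.det_fin_two] at this
  rw [continuous_iff_continuousAt]
  intro p
  induction p using OnePoint.rec with
  | infty =>
    rw [OnePoint.continuousAt_infty', coclosedCompact_eq_cocompact,
      ← Metric.cobounded_eq_cocompact]
    have hinv : Tendsto (fun w : ℂ => w⁻¹) (Bornology.cobounded ℂ) (𝓝 0) :=
      tendsto_inv₀_cobounded
    have hv : ((g 0 0, g 1 0) : ℂ × ℂ) ≠ 0 := by
      intro h
      rw [Prod.mk_eq_zero] at h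
      exact hdet (by rw [h.1, h.2]; ring)
    have hlim : Tendsto (fun w : ℂ => ((g 0 0 + g 0 1 * w⁻¹, g 1 0 + g 1 1 * w⁻¹) : ℂ × ℂ))
        (Bornology.cobounded ℂ) (𝓝 (g 0 0, g 1 0)) := by
      refine Tendsto.prodMk_nhds ?_ ?_
      · simpa using (hinv.const_mul (g 0 1)).const_add (g 0 0)
      · simpa using (hinv.const_mul (g 1 1)).const_add (g 1 0)
    have hq := (continuousAt_homog _ hv).tendsto.comp hlim
    have he : g • (∞ : OnePoint ℂ) = homog (g 0 0, g 1 0) := by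
      rw [OnePoint.smul_infty_eq_ite]; rfl
    rw [he]
    refine hq.congr' ?_
    have hne : ∀ᶠ w : ℂ in Bornology.cobounded ℂ, w ≠ 0 :=
      Bornology.eventually_ne_cobounded 0
    filter_upwards [hne] with w hw
    simp only [Function.comp, OnePoint.smul_some_eq_ite, homog]
    have e1 : g 1 0 + g 1 1 * w⁻¹ = (g 1 0 * w + g 1 1) / w := by field_simp
    have e0 : g 0 0 + g 0 1 * w⁻¹ = (g 0 0 * w + g 0 1) / w := by field_simp
    rw [e0, e1]
    by_cases h : g 1 0 * w + g 1 1 = 0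
    · simp [h]
    · rw [if_neg (div_ne_zero h hw), if_neg h, div_div_div_cancel_right₀ hw]
  | coe k =>
    rw [OnePoint.continuousAt_coe]
    have hv : ((g 0 0 * k + g 0 1, g 1 0 * k + g 1 1) : ℂ × ℂ) ≠ 0 := by
      intro h
      rw [Prod.mk_eq_zero] at h
      apply hdet
      by_cases h0 : g 1 0 = 0
      · have h11 : g 1 1 = 0 := by simpa [h0] using h.2
        rw [h0, h11]; ring
      · have : (g 0 0 * g 1 1 - g 0 1 * g 1 0) = g 0 0 * (g 1 0 * k + g 1 1)
            - g 1 0 * (g 0 0 * k + g 0 1) := by ring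
        rw [this, h.1, h.2]; ring
    have hcts : Continuous (fun k : ℂ =>
        ((g 0 0 * k + g 0 1, g 1 0 * k + g 1 1) : ℂ × ℂ)) := by fun_prop
    have hcomp := (continuousAt_homog _ hv).tendsto.comp (hcts.tendsto k)
    have heq : (fun p : OnePoint ℂ => g • p) ∘ OnePoint.some =
        homog ∘ fun k : ℂ => ((g 0 0 * k + g 0 1, g 1 0 * k + g 1 1) : ℂ × ℂ) := by
      funext w
      simp only [Function.comp, OnePoint.smul_some_eq_ite, homog]
    rw [heq]
    exact hcomp

theorem toSphere_smul (g : SL(2, ℝ)) (z : ℍ) :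
    toSphere (g • z) = ((g : GL (Fin 2) ℝ).map (algebraMap ℝ ℂ)) • toSphere z := by
  have hden := UpperHalfPlane.denom_ne_zero (g : GL (Fin 2) ℝ) z
  simp only [UpperHalfPlane.denom] at hden
  rw [toSphere, toSphere, OnePoint.smul_some_eq_ite, if_neg (by simpa using hden),
    UpperHalfPlane.specialLinearGroup_apply]
  simp

theorem bdryToSphere_smul (g : SL(2, ℝ)) (x : OnePoint ℝ) :
    bdryToSphere ((g : GL (Fin 2) ℝ) • x) =
      ((g : GL (Fin 2) ℝ).map (algebraMap ℝ ℂ)) • bdryToSphere x :=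
  OnePoint.map_smul _ _ _

/-- The points at infinity in the closure of a subset of the hyperbolic plane. -/
def idealPoints (A : Set ℍ) : Set (OnePoint ℝ) :=
  {x | bdryToSphere x ∈ closure (toSphere '' A)}

theorem smul_mem_idealPoints {A : Set ℍ} {g : SL(2, ℝ)} (hg : ∀ z ∈ A, g • z ∈ A)
    {x : OnePoint ℝ} (hx : x ∈ idealPoints A) : (g : GL (Fin 2) ℝ) • x ∈ idealPoints A := by
  change bdryToSphere _ ∈ closure (toSphere '' A)
  rw [bdryToSphere_smul]
  refine map_mem_closure (continuous_smul_sphere _) hx ?_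
  rintro _ ⟨z, hz, rfl⟩
  exact ⟨g • z, hg z hz, toSphere_smul g z⟩

/-- A point of the circle at infinity as an element of the ordered set `ℝ ∪ {+∞}`. -/
def bdryCoord (x : OnePoint ℝ) : WithTop ℝ := x.elim ⊤ fun r => (r : WithTop ℝ)

/-- `x ≺ z ≺ y` on the circle at infinity: the three points are distinct, and a path from `x` to `y`
in the positive (counterclockwise) direction meets `z`. As the plane lies to the left of `ℝ`, the
positive direction is that of increasing real numbers, closed up through `∞`. -/
def Between (x z y : OnePoint ℝ) : Prop :=
  (bdryCoord x < bdryCoord z ∧ bdryCoord z < bdryCoord y) ∨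
  (bdryCoord z < bdryCoord y ∧ bdryCoord y < bdryCoord x) ∨
  (bdryCoord y < bdryCoord x ∧ bdryCoord x < bdryCoord z)

end HypPlane

open HypPlane

/-! ### Hyperbolic surfaces and their universal covers -/

/-- An oriented hyperbolic metric with (possibly empty) geodesic boundary on the space `S`, together
with an identification of the universal cover `S̃`, with the lifted metric, with a subset of the
hyperbolic plane. As the path metric of `S̃` is the restriction of the hyperbolic distance and
the boundary of `S̃` is geodesic, this subset is closed and convex with non-empty interior, and its
frontier consists of complete geodesics. The last field says that the oriented metric of `S̃`
descends to `S`: near two points of the same fibre, the change of sheet is an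
orientation-preserving isometry. -/
structure HyperbolicSurface (S : Type*) [TopologicalSpace S] where
  /-- the universal cover, as a subset of the hyperbolic plane -/
  cover : Set ℍ
  /-- the universal covering map -/
  proj : cover → S
  isClosed_cover : IsClosed cover
  convex_cover : ∀ z ∈ cover, ∀ w ∈ cover, ∀ u : ℍ,
    dist z u + dist u w = dist z w → u ∈ cover
  interior_nonempty : (interior cover).Nonempty
  geodesic_frontier : ∀ z ∈ frontier cover, ∃ γ : ℝ → ℍ,
    Isometry γ ∧ γ 0 = z ∧ ∀ t, γ t ∈ frontier cover
  simplyConnected_cover : SimplyConnectedSpace cover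
  isCoveringMap_proj : IsCoveringMap proj
  surjective_proj : Function.Surjective proj
  metric_descends : ∀ z w : cover, proj z = proj w → ∃ g : SL(2, ℝ), g • (z : ℍ) = (w : ℍ) ∧
    ∀ᶠ u : cover in 𝓝 z, ∃ hu : g • (u : ℍ) ∈ cover, proj ⟨g • (u : ℍ), hu⟩ = proj u

namespace HyperbolicSurface

variable {S : Type*} [TopologicalSpace S] (X : HyperbolicSurface S)

/-- The group of deck transformations of the universal cover, i.e. the fundamental group of `S`,
as a group of isometries of the hyperbolic plane (`1` and `-1` act in the same way). -/
def deck : Subgroup SL(2, ℝ) where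
  carrier := {g | (∀ z : ℍ, g • z ∈ X.cover ↔ z ∈ X.cover) ∧
    ∀ (z : ℍ) (hz : z ∈ X.cover) (hgz : g • z ∈ X.cover), X.proj ⟨g • z, hgz⟩ = X.proj ⟨z, hz⟩}
  one_mem' := by simp
  mul_mem' := by
    rintro g h ⟨hg1, hg2⟩ ⟨hh1, hh2⟩
    refine ⟨fun z => by rw [mul_smul, hg1, hh1], fun z hz hgz => ?_⟩
    have hhz : h • z ∈ X.cover := (hh1 z).2 hz
    have hghz : g • h • z ∈ X.cover := (hg1 _).2 hhz
    rw [← hh2 z hz hhz, ← hg2 _ hhz hghz]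
    congr 2
    exact mul_smul g h z
  inv_mem' := by
    rintro g ⟨hg1, hg2⟩
    refine ⟨fun z => by rw [← hg1, smul_inv_smul], fun z hz hgz => ?_⟩
    have h : g • g⁻¹ • z ∈ X.cover := by rwa [smul_inv_smul]
    rw [← hg2 _ hgz h]
    congr 2
    exact smul_inv_smul g z

/-- The ideal boundary `∂_∞ S̃`. -/
def idealBoundary : Set (OnePoint ℝ) := idealPoints X.cover

instance : MulAction X.deck X.idealBoundary where
  smul g x := ⟨((g : SL(2, ℝ)) : GL (Fin 2) ℝ) • (x : OnePoint ℝ),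
    smul_mem_idealPoints (fun z hz => (g.2.1 z).2 hz) x.2⟩
  one_smul x := Subtype.ext (by
    change (((1 : SL(2, ℝ)) : GL (Fin 2) ℝ)) • (x : OnePoint ℝ) = x
    rw [map_one, one_smul])
  mul_smul g h x := Subtype.ext (by
    change (((g * h : SL(2, ℝ)) : GL (Fin 2) ℝ)) • (x : OnePoint ℝ) = _
    rw [map_mul, mul_smul]
    rfl)

/-- `[y₁, y₂]_∞`. -/
def closedInterval (y₁ y₂ : X.idealBoundary) : Set X.idealBoundary :=
  {y | y = y₁ ∨ y = y₂ ∨ Between y₁ y y₂}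

/-- `(y₁, y₂)_∞`. -/
def openInterval (y₁ y₂ : X.idealBoundary) : Set X.idealBoundary :=
  X.closedInterval y₁ y₂ \ {y₁, y₂}

/-- The space `𝒢(S̃)` of bi-infinite geodesics: unordered pairs of distinct ideal points. -/
def Geodesics : Type := {e : Sym2 X.idealBoundary // ¬ e.IsDiag}

/-- The geodesic with two given distinct endpoints. -/
def geodesic (p : {p : X.idealBoundary × X.idealBoundary // p.1 ≠ p.2}) : X.Geodesics :=
  ⟨s(p.1.1, p.1.2), by simpa using p.2⟩

/-- The quotient topology from ordered pairs of distinct points. -/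
instance : TopologicalSpace X.Geodesics := TopologicalSpace.coinduced X.geodesic inferInstance

instance : MeasurableSpace X.Geodesics := borel _

instance : BorelSpace X.Geodesics := ⟨rfl⟩

/-- The diagonal action of the deck group. -/
instance : SMul X.deck X.Geodesics where
  smul g e := ⟨e.1.map (g • ·), by
    rw [Sym2.isDiag_map (MulAction.injective g)]
    exact e.2⟩

/-- Geodesic currents: locally finite Borel measures on `𝒢(S̃)` invariant under the deck group. -/
structure IsGeodesicCurrent (c : Measure X.Geodesics) : Prop where
  locallyFinite : IsLocallyFiniteMeasure c
  invariant : SMulInvariantMeasure X.deck X.Geodesics c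

/-- The projection to `S` of the unit speed geodesic of `S̃` with the given endpoints is periodic,
that is, `e` determines a closed geodesic of `S`. -/
def ProjectsToClosed (e : X.Geodesics) : Prop :=
  ∃ γ : ℝ → X.cover, Isometry γ ∧
    (∃ a b : X.idealBoundary, e.1 = s(a, b) ∧
      Tendsto (fun t => toSphere (γ t)) atBot (𝓝 (bdryToSphere a)) ∧
      Tendsto (fun t => toSphere (γ t)) atTop (𝓝 (bdryToSphere b))) ∧
    ∃ T : ℝ, 0 < T ∧ Function.Periodic (X.proj ∘ γ) T

end HyperbolicSurface

end

/-! A geodesic current is finite on compact sets and invariant under the deck group. So a measurable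
set is null as soon as it has infinitely many translates that lie in one compact set of geodesics
and meet pairwise in null sets (`measure_eq_zero`). This is applied to the spike of geodesics
joining `x` to a closed set `Y` that misses `x`; a closed interval is such a set. In a coordinate
that puts `x` at `∞`, the points of `Y` have bounded real coordinates.

Suppose first that every deck transformation fixing `x` acts trivially. Take a ray of the cover
towards `x`. By cocompactness, points further and further along it are brought back to a compact set
by deck transformations `g n`. Seen from far along the ray, `Y` looks smaller still, so all the
translates of the spike stay in a compact set (`exists_translates_in_compact`). A geodesic common to
two translates has both `g m • x` and `g n • x` as ends. These ends differ by triviality of the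
stabilizer, so the intersection is at most one geodesic. That geodesic is not an atom: the same
argument applies to a single geodesic, because a deck transformation that exchanges its ends has a
fixed point on it and is trivial.

Otherwise some nontrivial deck transformation `h` fixes `x`. It cannot be parabolic, since the
injectivity radius is positive along the ray to `x`, so it is hyperbolic. Its axis is a closed
geodesic ending at `x`, so by hypothesis the other fixed point is not in `Y`. Contracting towards
that point by a high power of `h` makes `Y` disjoint from all its translates, while the coordinates
remain bounded (`measure_spike_of_contraction`). -/

namespace HypPlane

/-! ### The Möbius action on the circle at infinity -/

/-- `SL(2, ℝ)` acts on the circle at infinity by Möbius transformations. -/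
noncomputable instance : MulAction SL(2, ℝ) (OnePoint ℝ) :=
  MulAction.compHom _ (Matrix.SpecialLinearGroup.toGL (n := Fin 2) (R := ℝ))

theorem toGL_smul (g : SL(2, ℝ)) (x : OnePoint ℝ) : (g : GL (Fin 2) ℝ) • x = g • x := rfl

theorem smul_infty (g : SL(2, ℝ)) :
    g • (∞ : OnePoint ℝ) = if g 1 0 = 0 then ∞ else ((g 0 0 / g 1 0 : ℝ) : OnePoint ℝ) := by
  rw [← toGL_smul, OnePoint.smul_infty_eq_ite]
  rfl

theorem smul_coe (g : SL(2, ℝ)) (r : ℝ) :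
    g • (r : OnePoint ℝ) = if g 1 0 * r + g 1 1 = 0 then ∞ else
      (((g 0 0 * r + g 0 1) / (g 1 0 * r + g 1 1) : ℝ) : OnePoint ℝ) := by
  rw [← toGL_smul, OnePoint.smul_some_eq_ite]
  rfl

theorem smul_upper_coe (g : SL(2, ℝ)) (z : ℍ) :
    ((g • z : ℍ) : ℂ) = ((g 0 0 : ℂ) * z + g 0 1) / ((g 1 0 : ℂ) * z + g 1 1) := by
  simp [UpperHalfPlane.coe_specialLinearGroup_apply]

theorem det_eq_one (g : SL(2, ℝ)) : g 0 0 * g 1 1 - g 0 1 * g 1 0 = 1 := by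
  have := g.det_coe
  rwa [Matrix.det_fin_two] at this

theorem lower_left_eq_zero_of_smul_infty {g : SL(2, ℝ)} (h : g • (∞ : OnePoint ℝ) = ∞) :
    g 1 0 = 0 := by
  rw [smul_infty] at h
  by_contra h0
  rw [if_neg h0] at h
  exact OnePoint.coe_ne_infty _ h

/-! ### Continuity of the action on the circle -/

theorem bdryToSphere_injective : Function.Injective bdryToSphere :=
  Option.map_injective (algebraMap ℝ ℂ).injective

theorem continuous_bdryToSphere : Continuous bdryToSphere := by
  refine OnePoint.continuous_map Complex.continuous_ofReal ?_
  rw [coclosedCompact_eq_cocompact, coclosedCompact_eq_cocompact]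
  exact Complex.isometry_ofReal.isClosedEmbedding.tendsto_cocompact

theorem isClosedEmbedding_bdryToSphere : IsClosedEmbedding bdryToSphere :=
  continuous_bdryToSphere.isClosedEmbedding bdryToSphere_injective

instance : ContinuousConstSMul SL(2, ℝ) (OnePoint ℝ) where
  continuous_const_smul g := by
    rw [isClosedEmbedding_bdryToSphere.isInducing.continuous_iff]
    have : bdryToSphere ∘ (fun x : OnePoint ℝ => g • x) =
        fun x => ((g : GL (Fin 2) ℝ).map (algebraMap ℝ ℂ)) • bdryToSphere x :=
      funext fun x => bdryToSphere_smul g x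
    rw [this]
    exact (continuous_smul_sphere _).comp continuous_bdryToSphere

/-- Homogeneous coordinates absorb the case of a vanishing denominator, so that continuity in the
matrix follows from `continuousAt_homog`. -/
theorem bdryToSphere_smul_infty (g : SL(2, ℝ)) :
    bdryToSphere (g • ∞) = homog ((g 0 0 : ℂ), (g 1 0 : ℂ)) := by
  rw [smul_infty, homog]
  by_cases h : g 1 0 = 0
  · simp [h, bdryToSphere]
  · simp [h, bdryToSphere]

theorem bdryToSphere_smul_coe (g : SL(2, ℝ)) (r : ℝ) :
    bdryToSphere (g • (r : OnePoint ℝ)) =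
      homog (((g 0 0 * r + g 0 1 : ℝ) : ℂ), ((g 1 0 * r + g 1 1 : ℝ) : ℂ)) := by
  rw [smul_coe, homog]
  by_cases h : g 1 0 * r + g 1 1 = 0
  · simp only [h, bdryToSphere, if_true, Complex.ofReal_zero, OnePoint.map_infty]
  · simp only [h, bdryToSphere, if_false, Complex.ofReal_eq_zero, OnePoint.map_some]
    simp

theorem continuous_entry (i j : Fin 2) : Continuous fun g : SL(2, ℝ) => g i j :=
  (continuous_apply_apply i j).comp continuous_subtype_val

theorem continuous_smul_infty : Continuous fun g : SL(2, ℝ) => g • (∞ : OnePoint ℝ) := by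
  rw [isClosedEmbedding_bdryToSphere.isInducing.continuous_iff, continuous_iff_continuousAt]
  intro g
  have hv : ((g 0 0 : ℂ), (g 1 0 : ℂ)) ≠ 0 := by
    intro h
    rw [Prod.mk_eq_zero, Complex.ofReal_eq_zero, Complex.ofReal_eq_zero] at h
    have := det_eq_one g
    rw [h.1, h.2] at this
    simp at this
  have hc : Continuous fun g : SL(2, ℝ) => ((g 0 0 : ℂ), (g 1 0 : ℂ)) :=
    (Complex.continuous_ofReal.comp (continuous_entry 0 0)).prodMk
      (Complex.continuous_ofReal.comp (continuous_entry 1 0))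
  have := (continuousAt_homog _ hv).comp_of_eq (f := fun g : SL(2, ℝ) =>
    ((g 0 0 : ℂ), (g 1 0 : ℂ))) hc.continuousAt rfl
  exact this.congr (Eventually.of_forall fun g => (bdryToSphere_smul_infty g).symm)

theorem continuous_smul_coe :
    Continuous fun p : SL(2, ℝ) × ℝ => p.1 • (p.2 : OnePoint ℝ) := by
  rw [isClosedEmbedding_bdryToSphere.isInducing.continuous_iff, continuous_iff_continuousAt]
  rintro ⟨g, r⟩
  have hv : (((g 0 0 * r + g 0 1 : ℝ) : ℂ), ((g 1 0 * r + g 1 1 : ℝ) : ℂ)) ≠ 0 := by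
    intro h
    rw [Prod.mk_eq_zero, Complex.ofReal_eq_zero, Complex.ofReal_eq_zero] at h
    have := det_eq_one g
    have h3 : (1 : ℝ) = g 0 0 * (g 1 0 * r + g 1 1) - g 1 0 * (g 0 0 * r + g 0 1) := by
      linear_combination -this
    rw [h.1, h.2] at h3
    simp at h3
  have he := fun i j => (continuous_entry i j).comp (continuous_fst (X := SL(2, ℝ)) (Y := ℝ))
  have hr : Continuous fun p : SL(2, ℝ) × ℝ => p.2 := continuous_snd
  have hc : Continuous fun p : SL(2, ℝ) × ℝ =>
      (((p.1 0 0 * p.2 + p.1 0 1 : ℝ) : ℂ), ((p.1 1 0 * p.2 + p.1 1 1 : ℝ) : ℂ)) :=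
    (Complex.continuous_ofReal.comp (((he 0 0).mul hr).add (he 0 1))).prodMk
      (Complex.continuous_ofReal.comp (((he 1 0).mul hr).add (he 1 1)))
  have := (continuousAt_homog _ hv).comp_of_eq (f := fun p : SL(2, ℝ) × ℝ =>
      (((p.1 0 0 * p.2 + p.1 0 1 : ℝ) : ℂ), ((p.1 1 0 * p.2 + p.1 1 1 : ℝ) : ℂ)))
      (x := (g, r)) hc.continuousAt rfl
  exact this.congr (Eventually.of_forall fun p => (bdryToSphere_smul_coe p.1 p.2).symm)

/-! ### Special elements of `SL(2, ℝ)` -/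

/-- The translation `z ↦ z + r`. -/
noncomputable def translation (r : ℝ) : SL(2, ℝ) := ⟨!![1, r; 0, 1], by simp [Matrix.det_fin_two]⟩

/-- The dilation `z ↦ exp t * z`. -/
noncomputable def dilation (t : ℝ) : SL(2, ℝ) :=
  ⟨!![Real.exp (t / 2), 0; 0, Real.exp (-(t / 2))], by
    simp [Matrix.det_fin_two, ← Real.exp_add]⟩

/-- The rotation about `I` taking `∞` to `1 / δ`. -/
noncomputable def rotation (δ : ℝ) : SL(2, ℝ) :=
  ⟨!![(√(1 + δ ^ 2))⁻¹, -(δ * (√(1 + δ ^ 2))⁻¹); δ * (√(1 + δ ^ 2))⁻¹, (√(1 + δ ^ 2))⁻¹], by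
    have h : √(1 + δ ^ 2) * √(1 + δ ^ 2) = 1 + δ ^ 2 := Real.mul_self_sqrt (by positivity)
    have h0 : √(1 + δ ^ 2) ≠ 0 := by positivity
    rw [Matrix.det_fin_two_of]
    field_simp
    linear_combination -h⟩

/-- The unit speed vertical geodesic `t ↦ exp t * I`. -/
noncomputable def vert (t : ℝ) : ℍ := UpperHalfPlane.mk ⟨0, Real.exp t⟩ (Real.exp_pos t)

theorem isometry_vert : Isometry vert := UpperHalfPlane.isometry_vertical_line 0

theorem coe_vert (t : ℝ) : (vert t : ℂ) = Real.exp t * Complex.I := by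
  apply Complex.ext <;> simp [vert, -Complex.ofReal_exp]

theorem vert_zero : vert 0 = UpperHalfPlane.I := by
  apply UpperHalfPlane.ext; simp [coe_vert]

theorem translation_smul (r : ℝ) (z : ℍ) : ((translation r • z : ℍ) : ℂ) = z + r := by
  rw [smul_upper_coe]; simp [translation]

theorem translation_smul_coe (r s : ℝ) :
    translation r • (s : OnePoint ℝ) = ((s + r : ℝ) : OnePoint ℝ) := by
  rw [smul_coe]; simp [translation]

theorem translation_smul_infty (r : ℝ) : translation r • (∞ : OnePoint ℝ) = ∞ := by
  rw [smul_infty]; simp [translation]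

theorem dilation_smul_vert (t s : ℝ) : dilation t • vert s = vert (s + t) := by
  apply UpperHalfPlane.ext
  have h : (Complex.exp (-(t / 2))) ≠ 0 := Complex.exp_ne_zero _
  rw [smul_upper_coe, coe_vert, coe_vert]
  simp only [dilation, Matrix.of_apply, Matrix.cons_val', Matrix.cons_val_zero,
    Matrix.cons_val_one, Matrix.cons_val_fin_one]
  push_cast
  rw [zero_mul, zero_add, add_zero, div_eq_iff h]
  rw [mul_right_comm, ← mul_assoc, ← Complex.exp_add, ← Complex.exp_add]
  ring_nf

theorem dilation_smul_infty (t : ℝ) : dilation t • (∞ : OnePoint ℝ) = ∞ := by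
  rw [smul_infty]; simp [dilation]

theorem dilation_smul_coe (t r : ℝ) :
    dilation t • (r : OnePoint ℝ) = ((Real.exp t * r : ℝ) : OnePoint ℝ) := by
  rw [smul_coe]
  have h : Real.exp (-(t / 2)) ≠ 0 := (Real.exp_pos _).ne'
  simp only [dilation, Matrix.of_apply, Matrix.cons_val', Matrix.cons_val_zero,
    Matrix.cons_val_one, Matrix.cons_val_fin_one]
  rw [if_neg (by simp)]
  congr 1
  rw [zero_mul, zero_add, add_zero, div_eq_iff h, mul_right_comm, ← Real.exp_add]
  ring_nf

theorem toSL2R_smul_infty (z : ℍ) : z.toSL2R • (∞ : OnePoint ℝ) = ∞ := by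
  rw [smul_infty]; simp

theorem coe_toSL2R_smul_vert (z : ℍ) (t : ℝ) :
    ((z.toSL2R • vert t : ℍ) : ℂ) = z.re + (z.im * Real.exp t : ℝ) * Complex.I := by
  have h0 : √z.im ≠ 0 := (Real.sqrt_pos.2 z.im_pos).ne'
  have h1 : (√z.im : ℂ) ≠ 0 := by exact_mod_cast h0
  have h : (√z.im : ℂ) * √z.im = z.im := by
    exact_mod_cast Real.mul_self_sqrt z.im_pos.le
  rw [smul_upper_coe, coe_vert]
  simp only [UpperHalfPlane.coe_toSL2R, Matrix.of_apply, Matrix.cons_val', Matrix.cons_val_zero,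
    Matrix.cons_val_one, Matrix.cons_val_fin_one]
  push_cast
  rw [← h]
  field_simp
  ring

theorem continuous_rotation : Continuous rotation := by
  refine Matrix.SpecialLinearGroup.isClosedEmbedding_val.isInducing.continuous_iff.2 ?_
  have : ∀ δ : ℝ, √(1 + δ ^ 2) ≠ 0 := fun δ => by positivity
  change Continuous fun δ : ℝ => !![(√(1 + δ ^ 2))⁻¹, -(δ * (√(1 + δ ^ 2))⁻¹);
    δ * (√(1 + δ ^ 2))⁻¹, (√(1 + δ ^ 2))⁻¹]
  fun_prop (disch := exact this)

theorem rotation_zero : rotation 0 = 1 := by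
  ext i j; fin_cases i <;> fin_cases j <;> simp [rotation]

theorem coe_rotation_smul (δ : ℝ) (z : ℍ) :
    ((rotation δ • z : ℍ) : ℂ) = (z - δ) / (δ * z + 1) := by
  have h1 : ((√(1 + δ ^ 2) : ℝ) : ℂ) ≠ 0 := by
    exact_mod_cast (show √(1 + δ ^ 2) ≠ 0 by positivity)
  rw [smul_upper_coe]
  simp only [rotation, Matrix.of_apply, Matrix.cons_val', Matrix.cons_val_zero,
    Matrix.cons_val_one, Matrix.cons_val_fin_one]
  push_cast
  rw [← mul_div_mul_left (z - δ : ℂ) _ (inv_ne_zero h1)]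
  congr 1 <;> ring

theorem rotation_smul_I (δ : ℝ) : rotation δ • UpperHalfPlane.I = UpperHalfPlane.I := by
  apply UpperHalfPlane.ext
  have h : (δ * Complex.I + 1 : ℂ) ≠ 0 := by
    intro h; simpa using congrArg Complex.re h
  rw [coe_rotation_smul, UpperHalfPlane.coe_I, div_eq_iff h]
  linear_combination -δ * Complex.I_mul_I

theorem rotation_smul_infty {δ : ℝ} (h : δ ≠ 0) :
    rotation δ • (∞ : OnePoint ℝ) = ((δ⁻¹ : ℝ) : OnePoint ℝ) := by
  have h0 : √(1 + δ ^ 2) ≠ 0 := by positivity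
  rw [smul_infty]
  simp only [rotation, Matrix.of_apply, Matrix.cons_val', Matrix.cons_val_zero,
    Matrix.cons_val_one, Matrix.cons_val_fin_one]
  rw [if_neg (by positivity)]
  congr 1
  field_simp

/-- The map `z ↦ -1 / z`. -/
noncomputable def quarterTurn : SL(2, ℝ) := ⟨!![0, -1; 1, 0], by simp [Matrix.det_fin_two]⟩

theorem quarterTurn_smul_I : quarterTurn • UpperHalfPlane.I = UpperHalfPlane.I := by
  apply UpperHalfPlane.ext
  rw [smul_upper_coe]
  simp [quarterTurn, div_eq_mul_inv]

theorem quarterTurn_smul_infty :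
    quarterTurn • (∞ : OnePoint ℝ) = ((0 : ℝ) : OnePoint ℝ) := by
  rw [smul_infty]
  simp [quarterTurn]

/-- Rotations about `I` move `∞` to any ideal point, and `toSL2R` moves `I` to any point. This
supplies a frame based at `z` and looking towards `x`. -/
theorem exists_smul_I_smul_infty (x : OnePoint ℝ) (z : ℍ) :
    ∃ k : SL(2, ℝ), k • UpperHalfPlane.I = z ∧ k • (∞ : OnePoint ℝ) = x := by
  have key : ∀ x : OnePoint ℝ,
      ∃ k : SL(2, ℝ), k • UpperHalfPlane.I = UpperHalfPlane.I ∧ k • (∞ : OnePoint ℝ) = x := by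
    intro x
    induction x using OnePoint.rec with
    | infty => exact ⟨1, one_smul _ _, one_smul _ _⟩
    | coe r =>
      rcases eq_or_ne r 0 with rfl | hr
      · exact ⟨quarterTurn, quarterTurn_smul_I, quarterTurn_smul_infty⟩
      · exact ⟨rotation r⁻¹, rotation_smul_I _, by
          rw [rotation_smul_infty (inv_ne_zero hr), inv_inv]⟩
  obtain ⟨k, h1, h2⟩ := key (z.toSL2R⁻¹ • x)
  exact ⟨z.toSL2R * k, by rw [mul_smul, h1, UpperHalfPlane.toSL2R_smul_I],
    by rw [mul_smul, h2, smul_inv_smul]⟩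

theorem exists_smul_infty_smul_zero {x y : OnePoint ℝ} (h : x ≠ y) :
    ∃ k : SL(2, ℝ), k • (∞ : OnePoint ℝ) = x ∧ k • ((0 : ℝ) : OnePoint ℝ) = y := by
  obtain ⟨k, -, hk⟩ := exists_smul_I_smul_infty x UpperHalfPlane.I
  have hy : k⁻¹ • y ≠ ∞ := by
    intro h'
    exact h (by rw [← hk, ← h', smul_inv_smul])
  obtain ⟨r, hr⟩ := OnePoint.ne_infty_iff_exists.1 hy
  exact ⟨k * translation r, by rw [mul_smul, translation_smul_infty, hk], by
    rw [mul_smul, translation_smul_coe, zero_add, hr, smul_inv_smul]⟩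

/-- An orientation-preserving isometry with two fixed points is the identity. -/
theorem smul_eq_self_of_two_fixed {g : SL(2, ℝ)} {u v : ℍ} (huv : u ≠ v) (hu : g • u = u)
    (hv : g • v = v) (z : ℍ) : g • z = z := by
  -- A fixed point is a root of a quadratic with real coefficients, which has at most one root in
  -- the upper half plane unless it vanishes identically.
  have key : ∀ w : ℍ, g • w = w →
      (g 1 0 : ℂ) * w ^ 2 + (g 1 1 - g 0 0) * w - g 0 1 = 0 := by
    intro w hw
    have hd := UpperHalfPlane.denom_ne_zero (g : GL (Fin 2) ℝ) w
    have hd' : (g 1 0 : ℂ) * w + g 1 1 ≠ 0 := hd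
    have := congrArg ((↑) : ℍ → ℂ) hw
    rw [smul_upper_coe, div_eq_iff hd'] at this
    linear_combination -this
  have im_eq : ∀ w : ℍ, g • w = w → w.im * (2 * g 1 0 * w.re + (g 1 1 - g 0 0)) = 0 := by
    intro w hw
    have := congrArg Complex.im (key w hw)
    simp [sq] at this
    linarith
  have re_eq : ∀ w : ℍ, g • w = w →
      g 1 0 * (w.re ^ 2 - w.im ^ 2) + (g 1 1 - g 0 0) * w.re - g 0 1 = 0 := by
    intro w hw
    have := congrArg Complex.re (key w hw)
    simp [sq] at this
    linarith
  have iu := (mul_eq_zero.1 (im_eq u hu)).resolve_left u.im_pos.ne'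
  have iv := (mul_eq_zero.1 (im_eq v hv)).resolve_left v.im_pos.ne'
  have ru := re_eq u hu
  have rv := re_eq v hv
  have hc : g 1 0 = 0 := by
    by_contra hc
    apply huv
    have hre : u.re = v.re := by
      have : g 1 0 * (u.re - v.re) = 0 := by linarith
      linarith [(mul_eq_zero.1 this).resolve_left hc]
    have him : u.im = v.im := by
      rw [hre] at ru
      have : g 1 0 * ((u.im - v.im) * (u.im + v.im)) = 0 := by linarith
      have := (mul_eq_zero.1 this).resolve_left hc
      have := (mul_eq_zero.1 this).resolve_right (by linarith [u.im_pos, v.im_pos])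
      linarith
    exact UpperHalfPlane.ext (Complex.ext hre him)
  rw [hc] at iu ru
  have hda : g 1 1 = g 0 0 := by linarith
  have hb : g 0 1 = 0 := by rw [hda] at ru; linarith
  have hdet := det_eq_one g
  rw [hc, hb, hda] at hdet
  have ha : g 0 0 ≠ 0 := by rintro h; rw [h] at hdet; simp at hdet
  apply UpperHalfPlane.ext
  rw [smul_upper_coe, hc, hb, hda]
  have ha' : (g 0 0 : ℂ) ≠ 0 := by exact_mod_cast ha
  simp [mul_div_cancel_left₀ _ ha']

/-! ### Closed convex sets and their ideal points -/

/-- Allows an ideal point to be approached in the coordinate given by `k`, where it can be placed at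
`∞` or `0`. -/
theorem exists_mem_of_mem_idealPoints {A : Set ℍ} {k : SL(2, ℝ)} {x : OnePoint ℝ}
    (h : k • x ∈ idealPoints A) {U : Set (OnePoint ℂ)} (hU : U ∈ 𝓝 (bdryToSphere x)) :
    ∃ z ∈ A, toSphere (k⁻¹ • z) ∈ U := by
  have hx : k⁻¹ • k • x = x := inv_smul_smul _ _
  have hb := bdryToSphere_smul k⁻¹ (k • x)
  rw [toGL_smul, hx] at hb
  rw [hb] at hU
  have hV := (continuous_smul_sphere
    (((k⁻¹ : SL(2, ℝ)) : GL (Fin 2) ℝ).map (algebraMap ℝ ℂ))).continuousAt.preimage_mem_nhds hU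
  obtain ⟨_, hp, z, hz, rfl⟩ := mem_closure_iff_nhds.1 h _ hV
  exact ⟨z, hz, by rw [toSphere_smul]; exact hp⟩

theorem exists_lt_norm_of_mem_idealPoints {A : Set ℍ} {k : SL(2, ℝ)}
    (h : k • (∞ : OnePoint ℝ) ∈ idealPoints A) (R : ℝ) :
    ∃ z ∈ A, R < ‖((k⁻¹ • z : ℍ) : ℂ)‖ := by
  have hU : ((↑) '' Metric.closedBall (0 : ℂ) R : Set (OnePoint ℂ))ᶜ ∈ 𝓝 (bdryToSphere ∞) :=
    (OnePoint.isOpen_compl_image_coe.2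
      ⟨Metric.isClosed_closedBall, isCompact_closedBall _ _⟩).mem_nhds
        OnePoint.infty_notMem_image_coe
  obtain ⟨z, hz, hzU⟩ := exists_mem_of_mem_idealPoints h hU
  refine ⟨z, hz, not_le.1 fun hle => hzU ⟨_, ?_, rfl⟩⟩
  simpa using hle

theorem exists_norm_lt_of_mem_idealPoints {A : Set ℍ} {k : SL(2, ℝ)}
    (h : k • ((0 : ℝ) : OnePoint ℝ) ∈ idealPoints A) {ε : ℝ} (hε : 0 < ε) :
    ∃ z ∈ A, ‖((k⁻¹ • z : ℍ) : ℂ)‖ < ε := by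
  have hU : ((↑) '' Metric.ball (0 : ℂ) ε : Set (OnePoint ℂ)) ∈
      𝓝 (bdryToSphere ((0 : ℝ) : OnePoint ℝ)) :=
    (OnePoint.isOpen_image_coe.2 Metric.isOpen_ball).mem_nhds
      ⟨0, by simpa using hε, by simp [bdryToSphere]⟩
  obtain ⟨z, hz, u, hu, huz⟩ := exists_mem_of_mem_idealPoints h hU
  refine ⟨z, hz, ?_⟩
  rw [← OnePoint.coe_injective huz]
  simpa using hu

/-- Polar coordinates about `I`, with the direction measured from the vertical. -/
theorem exists_rotation_smul_vert_eq (w : ℍ) (hw : 2 < ‖(w : ℂ)‖) :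
    ∃ δ s : ℝ, |δ| ≤ 2 / ‖(w : ℂ)‖ ∧ (‖(w : ℂ)‖ - 1) / 3 ≤ Real.exp s ∧
      rotation δ • vert s = w := by
  set N := ‖(w : ℂ)‖ with hN
  have hNsq : N ^ 2 = w.re ^ 2 + w.im ^ 2 := by
    rw [hN, ← Complex.normSq_eq_norm_sq, Complex.normSq_apply]
    simp only [UpperHalfPlane.coe_re, UpperHalfPlane.coe_im]
    ring
  set M := N ^ 2 - 1 with hM
  have hMpos : 0 < M := by nlinarith
  set D := √(M ^ 2 + 4 * w.re ^ 2) with hD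
  have hDsq : D ^ 2 = M ^ 2 + 4 * w.re ^ 2 := Real.sq_sqrt (by positivity)
  have hDM : M ≤ D := Real.le_sqrt_of_sq_le (by nlinarith [sq_nonneg w.re])
  have hMD : 0 < M + D := by linarith
  -- The small root of `hquad`, the condition that rotating `w` back by `δ` lands on the imaginary
  -- axis. The rationalised form also covers `w.re = 0`.
  set δ := 2 * w.re / (M + D) with hδ
  have hδeq : δ * (M + D) = 2 * w.re := div_mul_cancel₀ _ hMD.ne'
  have hquad : δ ^ 2 * w.re + δ * M - w.re = 0 := by
    have : (M + D) ^ 2 * (δ ^ 2 * w.re + δ * M - w.re) = 0 := by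
      have e : (M + D) ^ 2 * (δ ^ 2 * w.re + δ * M - w.re) =
        (δ * (M + D)) ^ 2 * w.re + (δ * (M + D)) * (M + D) * M - (M + D) ^ 2 * w.re := by ring
      rw [e, hδeq]
      linear_combination -w.re * hDsq
    exact (mul_eq_zero.1 this).resolve_left (by positivity)
  have hre : |w.re| ≤ N := Complex.abs_re_le_norm (w : ℂ)
  have hδle : |δ| ≤ 2 / N := by
    rw [hδ, abs_div, abs_of_pos hMD, div_le_div_iff₀ hMD (by linarith), abs_mul, abs_two]
    nlinarith [abs_nonneg w.re]
  have hδN : |δ| * N ≤ 2 := by rwa [le_div_iff₀ (by linarith)] at hδle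
  have hδ1 : |δ| ≤ 1 := hδle.trans (by rw [div_le_one (by linarith)]; linarith)
  have hwim : (w : ℂ).im = w.im := rfl
  have hwre : (w : ℂ).re = w.re := rfl
  have hden : (1 - δ * w : ℂ) ≠ 0 := by
    intro h
    have him := congrArg Complex.im h
    have hr := congrArg Complex.re h
    simp at him hr
    rcases him with h0 | h0
    · rw [h0] at hr; simp at hr
    · exact w.im_pos.ne' h0
  -- The image of `w` under the inverse of `rotation δ`; its height determines `s`.
  set q : ℂ := (w + δ) / (1 - δ * w) with hq
  have hnsq : 0 < Complex.normSq (1 - δ * w) := Complex.normSq_pos.2 hden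
  have hqre : q.re = 0 := by
    rw [hq, Complex.div_re, ← add_div, div_eq_zero_iff]
    left
    simp only [Complex.add_re, Complex.add_im, Complex.sub_re, Complex.sub_im, Complex.mul_re,
      Complex.mul_im, Complex.ofReal_re, Complex.ofReal_im, Complex.one_re, Complex.one_im,
      hwre, hwim]
    linear_combination -hquad + δ * hNsq + δ * hM
  have hqim : 0 < q.im := by
    rw [hq, Complex.div_im, ← sub_div]
    refine div_pos ?_ hnsq
    simp only [Complex.add_re, Complex.add_im, Complex.sub_re, Complex.sub_im, Complex.mul_re,
      Complex.mul_im, Complex.ofReal_re, Complex.ofReal_im, Complex.one_re, Complex.one_im,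
      hwre, hwim]
    have := w.im_pos
    nlinarith [mul_nonneg (sq_nonneg δ) this.le]
  have hqeq : q = q.im * Complex.I := by
    apply Complex.ext <;> simp [hqre]
  have hqn : q.im = ‖q‖ := by
    rw [hqeq]
    simp [abs_of_pos hqim]
  refine ⟨δ, Real.log q.im, hδle, ?_, ?_⟩
  · rw [Real.exp_log hqim, hqn, hq, norm_div]
    have h1 : N - 1 ≤ ‖(w + δ : ℂ)‖ := by
      have := norm_sub_le (w + δ : ℂ) δ
      rw [add_sub_cancel_right, Complex.norm_real, Real.norm_eq_abs] at this
      linarith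
    have h2 : ‖(1 - δ * w : ℂ)‖ ≤ 3 := by
      have := norm_sub_le (1 : ℂ) (δ * w)
      rw [norm_one, norm_mul, Complex.norm_real, Real.norm_eq_abs] at this
      linarith
    exact div_le_div₀ (norm_nonneg _) h1 (norm_pos_iff.2 hden) h2
  · apply UpperHalfPlane.ext
    rw [coe_rotation_smul, coe_vert, Real.exp_log hqim, ← hqeq]
    have h3 : (δ * q + 1 : ℂ) = (1 + δ ^ 2) / (1 - δ * w) := by
      rw [hq, eq_div_iff hden, add_mul, mul_assoc, div_mul_cancel₀ _ hden]; ring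
    have h4 : (1 + δ ^ 2 : ℂ) ≠ 0 := by
      exact_mod_cast (show (1 + δ ^ 2 : ℝ) ≠ 0 by positivity)
    have h5 : (q - δ : ℂ) = w * (1 + δ ^ 2) / (1 - δ * w) := by
      rw [hq, eq_div_iff hden, sub_mul, div_mul_cancel₀ _ hden]; ring
    rw [h3, h5, div_div_div_cancel_right₀ hden, mul_div_cancel_right₀ _ h4]

/-- A closed convex set contains the rays from its points to its ideal points. -/
theorem smul_vert_mem_of_nonneg {A : Set ℍ} (hA : IsClosed A)
    (hconv : ∀ z ∈ A, ∀ w ∈ A, ∀ u : ℍ, dist z u + dist u w = dist z w → u ∈ A)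
    {k : SL(2, ℝ)} (hI : k • UpperHalfPlane.I ∈ A)
    (hx : k • (∞ : OnePoint ℝ) ∈ idealPoints A) {t : ℝ} (ht : 0 ≤ t) : k • vert t ∈ A := by
  -- The shift by `2` makes polar coordinates available for every `n`.
  choose z hz hzn using fun n : ℕ => exists_lt_norm_of_mem_idealPoints hx (n + 2)
  have hgt : ∀ n : ℕ, 2 < ‖((k⁻¹ • z n : ℍ) : ℂ)‖ := fun n => by
    have := hzn n
    have : (0 : ℝ) ≤ n := n.cast_nonneg
    linarith [hzn n]
  choose δ s hδ hs hw using fun n : ℕ => exists_rotation_smul_vert_eq (k⁻¹ • z n) (hgt n)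
  have hnat : Tendsto (fun n : ℕ => (n : ℝ)) atTop atTop := tendsto_natCast_atTop_atTop
  have hnorm : Tendsto (fun n : ℕ => ‖((k⁻¹ • z n : ℍ) : ℂ)‖) atTop atTop :=
    tendsto_atTop_mono (fun n => by linarith [hzn n]) hnat
  have hδ0 : Tendsto δ atTop (𝓝 0) := by
    rw [tendsto_zero_iff_abs_tendsto_zero]
    exact squeeze_zero (fun n => abs_nonneg _) hδ (hnorm.const_div_atTop 2)
  have hst : ∀ᶠ n in atTop, t ≤ s n := by
    filter_upwards [hnorm.eventually_ge_atTop (3 * Real.exp t + 1)] with n hn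
    refine Real.exp_le_exp.1 (le_trans ?_ (hs n))
    linarith
  -- The point at distance `t` on the segment from the base point to `z n`; the directions `δ n`
  -- tend to the vertical.
  have hlim : Tendsto (fun n => k • rotation (δ n) • vert t) atTop (𝓝 (k • vert t)) := by
    have h1 := (continuous_rotation.tendsto 0).comp hδ0
    rw [rotation_zero] at h1
    have h2 := (h1.smul_const (vert t)).const_smul k
    rwa [one_smul] at h2
  refine hA.mem_of_tendsto hlim ?_
  filter_upwards [hst] with n hn
  have hz' : k • rotation (δ n) • vert (s n) = z n := by rw [hw, smul_inv_smul]
  refine hconv _ hI _ (hz n) _ ?_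
  have hI' : k • UpperHalfPlane.I = k • rotation (δ n) • vert 0 := by
    rw [vert_zero, rotation_smul_I]
  rw [hI', ← hz']
  simp only [dist_smul, isometry_vert.dist_eq, Real.dist_eq]
  rw [abs_of_nonpos (by linarith), abs_of_nonpos (by linarith), abs_of_nonpos (by linarith)]
  ring

/-- A closed convex set contains the geodesics joining its ideal points. -/
theorem smul_vert_mem {A : Set ℍ} (hA : IsClosed A)
    (hconv : ∀ z ∈ A, ∀ w ∈ A, ∀ u : ℍ, dist z u + dist u w = dist z w → u ∈ A)
    {k : SL(2, ℝ)} (hx : k • (∞ : OnePoint ℝ) ∈ idealPoints A)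
    (hy : k • ((0 : ℝ) : OnePoint ℝ) ∈ idealPoints A) (t : ℝ) : k • vert t ∈ A := by
  choose z hz hzn using fun n : ℕ =>
    exists_norm_lt_of_mem_idealPoints hy (ε := 1 / ((n : ℝ) + 1)) (by positivity)
  set u : ℕ → ℍ := fun n => k⁻¹ • z n with hu
  have hu0 : Tendsto (fun n => (u n : ℂ)) atTop (𝓝 0) :=
    squeeze_zero_norm (fun n => (hzn n).le) tendsto_one_div_add_atTop_nhds_zero_nat
  have hre : Tendsto (fun n => (u n).re) atTop (𝓝 0) :=
    (Complex.continuous_re.tendsto 0).comp hu0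
  have him : Tendsto (fun n => (u n).im) atTop (𝓝 0) :=
    (Complex.continuous_im.tendsto 0).comp hu0
  -- The vertical ray from `u n` reaches height `exp t` at time `t - log (u n).im`, which is
  -- nonnegative once `u n` is low enough; these rays converge to the whole geodesic.
  have hlim : Tendsto (fun n => k • (u n).toSL2R • vert (t - Real.log (u n).im)) atTop
      (𝓝 (k • vert t)) := by
    refine Tendsto.const_smul ?_ k
    rw [UpperHalfPlane.isEmbedding_coe.tendsto_nhds_iff]
    have : ∀ n, (((u n).toSL2R • vert (t - Real.log (u n).im) : ℍ) : ℂ) =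
        (u n).re + vert t := by
      intro n
      rw [coe_toSL2R_smul_vert, coe_vert, Real.exp_sub, Real.exp_log (u n).im_pos,
        mul_div_cancel₀ _ (u n).im_pos.ne']
    simp only [Function.comp_def, this]
    simpa using ((Complex.continuous_ofReal.tendsto 0).comp hre).add_const (vert t : ℂ)
  refine hA.mem_of_tendsto hlim ?_
  filter_upwards [him.eventually_le_const (Real.exp_pos t)] with n hn
  rw [← mul_smul]
  refine smul_vert_mem_of_nonneg hA hconv ?_ ?_ ?_
  · rw [mul_smul, UpperHalfPlane.toSL2R_smul_I, hu, smul_inv_smul]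
    exact hz n
  · rwa [mul_smul, toSL2R_smul_infty]
  · have := (Real.log_le_iff_le_exp (u n).im_pos).2 hn
    linarith

/-! ### Endpoints of geodesics -/

theorem tendsto_toSphere_vert_atTop :
    Tendsto (fun t => toSphere (vert t)) atTop (𝓝 (bdryToSphere ∞)) := by
  have h : Tendsto (fun t => (vert t : ℂ)) atTop (coclosedCompact ℂ) := by
    rw [coclosedCompact_eq_cocompact, ← Metric.cobounded_eq_cocompact,
      ← tendsto_norm_atTop_iff_cobounded]
    refine Real.tendsto_exp_atTop.congr fun t => ?_
    rw [coe_vert, norm_mul, Complex.norm_I, mul_one, Complex.norm_real, Real.norm_eq_abs,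
      abs_of_pos (Real.exp_pos t)]
  exact OnePoint.tendsto_coe_infty.comp h

theorem tendsto_toSphere_vert_atBot :
    Tendsto (fun t => toSphere (vert t)) atBot (𝓝 (bdryToSphere ((0 : ℝ) : OnePoint ℝ))) := by
  have h : Tendsto (fun t => (vert t : ℂ)) atBot (𝓝 0) := by
    have := ((Complex.continuous_ofReal.tendsto 0).comp Real.tendsto_exp_atBot).mul_const Complex.I
    simpa [coe_vert, Function.comp_def] using this
  have := (OnePoint.continuous_coe.tendsto (0 : ℂ)).comp h
  simpa [bdryToSphere, Function.comp_def, toSphere] using this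

theorem tendsto_toSphere_smul (k : SL(2, ℝ)) {γ : ℝ → ℍ} {l : Filter ℝ} {x : OnePoint ℝ}
    (h : Tendsto (fun t => toSphere (γ t)) l (𝓝 (bdryToSphere x))) :
    Tendsto (fun t => toSphere (k • γ t)) l (𝓝 (bdryToSphere (k • x))) := by
  have hb := bdryToSphere_smul k x
  rw [toGL_smul] at hb
  simp only [toSphere_smul, hb]
  exact ((continuous_smul_sphere _).tendsto _).comp h

/-- The pairs of endpoints `(g ∞, g r)`, for `g I` in a compact set and bounded `r`, form a compact
set. -/
theorem isCompact_image_endpoints {C : Set ℍ} (hC : IsCompact C) {R : Set ℝ} (hR : IsCompact R) :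
    IsCompact ((fun p : SL(2, ℝ) × ℝ =>
      ((p.1 • ∞, p.1 • (p.2 : OnePoint ℝ)) : OnePoint ℝ × OnePoint ℝ)) ''
        (((fun g : SL(2, ℝ) => g • UpperHalfPlane.I) ⁻¹' C) ×ˢ R)) :=
  ((UpperHalfPlane.isProperMap_smul_I.isCompact_preimage hC).prod hR).image
    ((continuous_smul_infty.comp continuous_fst).prodMk continuous_smul_coe)

/-! ### Isometries fixing `∞` as affine maps -/

theorem coe_smul_of_lower_left_eq_zero {g : SL(2, ℝ)} (h : g 1 0 = 0) (z : ℍ) :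
    ((g • z : ℍ) : ℂ) = ((g 0 0 ^ 2 : ℝ) : ℂ) * z + ((g 0 0 * g 0 1 : ℝ) : ℂ) := by
  have hdet := det_eq_one g
  rw [h, mul_zero, sub_zero] at hdet
  have hd : g 1 1 ≠ 0 := by rintro h0; rw [h0] at hdet; simp at hdet
  have hd' : (g 1 1 : ℂ) ≠ 0 := by exact_mod_cast hd
  have hdet' : (g 0 0 : ℂ) * g 1 1 = 1 := by exact_mod_cast hdet
  rw [smul_upper_coe, h, Complex.ofReal_zero, zero_mul, zero_add, div_eq_iff hd']
  push_cast
  linear_combination (-g 0 0 * z - g 0 1 : ℂ) * hdet'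

theorem smul_coe_of_lower_left_eq_zero {g : SL(2, ℝ)} (h : g 1 0 = 0) (r : ℝ) :
    g • (r : OnePoint ℝ) = ((g 0 0 ^ 2 * r + g 0 0 * g 0 1 : ℝ) : OnePoint ℝ) := by
  have hdet := det_eq_one g
  rw [h, mul_zero, sub_zero] at hdet
  have hd : g 1 1 ≠ 0 := by rintro h0; rw [h0] at hdet; simp at hdet
  rw [smul_coe, h, zero_mul, zero_add, if_neg hd]
  congr 1
  rw [div_eq_iff hd]
  linear_combination (-g 0 0 * r - g 0 1) * hdet

end HypPlane

open HypPlane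

namespace HyperbolicSurface

variable {S : Type*} [TopologicalSpace S] (X : HyperbolicSurface S)

/-! ### The deck group -/

instance : PathConnectedSpace X.cover :=
  have := X.simplyConnected_cover
  inferInstance

instance : Nontrivial X.cover := by
  obtain ⟨z, hz⟩ := X.interior_nonempty
  have hmem : X.cover ∈ 𝓝 z := mem_interior_iff_mem_nhds.1 hz
  obtain ⟨w, hw, hne⟩ := (((𝓝[≠] z).inter_mem (mem_nhdsWithin_of_mem_nhds hmem)
    self_mem_nhdsWithin : X.cover ∩ {z}ᶜ ∈ 𝓝[≠] z) |> Filter.nonempty_of_mem)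
  exact ⟨⟨w, hw⟩, ⟨z, interior_subset hz⟩, fun h => hne (congrArg Subtype.val h)⟩

instance : LocallyCompactSpace X.cover :=
  X.isClosed_cover.isClosedEmbedding_subtypeVal.locallyCompactSpace

theorem exists_isOpen_injOn_proj (z : X.cover) : ∃ U, IsOpen U ∧ z ∈ U ∧ InjOn X.proj U := by
  obtain ⟨e, hz, he⟩ := X.isCoveringMap_proj.isLocalHomeomorph z
  exact ⟨e.source, e.open_source, hz, he ▸ e.injOn⟩

theorem eventually_ne_of_cover (z : X.cover) {p : X.cover → Prop} (h : ∀ᶠ v in 𝓝 z, p v) :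
    ∃ v, v ≠ z ∧ p v := by
  obtain ⟨v, hv, hne⟩ := (((𝓝[≠] z).inter_mem (mem_nhdsWithin_of_mem_nhds h)
    self_mem_nhdsWithin : {v | p v} ∩ {z}ᶜ ∈ 𝓝[≠] z) |> Filter.nonempty_of_mem)
  exact ⟨v, hne, hv⟩

/-- The isometry `g` maps the point `u` of the universal cover to a point of the same fibre. -/
def PreservesFiberAt (g : SL(2, ℝ)) (u : X.cover) : Prop :=
  ∃ hu : g • (u : ℍ) ∈ X.cover, X.proj ⟨g • (u : ℍ), hu⟩ = X.proj u

variable {X}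

theorem PreservesFiberAt.congr {g g' : SL(2, ℝ)} {u : X.cover} (h : X.PreservesFiberAt g u)
    (hg : g • (u : ℍ) = g' • (u : ℍ)) : X.PreservesFiberAt g' u := by
  obtain ⟨hu, hp⟩ := h
  exact ⟨hg ▸ hu, by rw [← hp]; congr 2; exact hg.symm⟩

theorem eventually_smul_mem {g : SL(2, ℝ)} {u : X.cover} (hu : g • (u : ℍ) ∈ X.cover)
    {U : Set X.cover} (hU : U ∈ 𝓝 (⟨g • (u : ℍ), hu⟩ : X.cover)) :
    ∀ᶠ v : X.cover in 𝓝 u, ∀ hv : g • (v : ℍ) ∈ X.cover, (⟨g • (v : ℍ), hv⟩ : X.cover) ∈ U := by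
  obtain ⟨V, hV, hVU⟩ := mem_nhds_subtype _ _ _ |>.1 hU
  have hc : Continuous fun v : X.cover => g • (v : ℍ) :=
    (continuous_const_smul g).comp continuous_subtype_val
  filter_upwards [hc.continuousAt.preimage_mem_nhds hV] with v hv hv'
  exact hVU hv

theorem isClosed_preservesFiberAt [T2Space S] (g : SL(2, ℝ)) :
    IsClosed {u | X.PreservesFiberAt g u} := by
  have hc : Continuous fun v : X.cover => g • (v : ℍ) :=
    (continuous_const_smul g).comp continuous_subtype_val
  have hs : IsClosed {u : X.cover | g • (u : ℍ) ∈ X.cover} := X.isClosed_cover.preimage hc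
  have hp := X.isCoveringMap_proj.continuous
  have heq : IsClosed {u : {u : X.cover | g • (u : ℍ) ∈ X.cover} |
      X.proj ⟨g • ((u : X.cover) : ℍ), u.2⟩ = X.proj u} :=
    isClosed_eq (hp.comp ((hc.comp continuous_subtype_val).subtype_mk _))
      (hp.comp continuous_subtype_val)
  convert hs.isClosedEmbedding_subtypeVal.isClosedMap _ heq using 1
  ext u
  constructor
  · rintro ⟨hu, h⟩
    exact ⟨⟨u, hu⟩, h, rfl⟩
  · rintro ⟨⟨u, hu⟩, h, rfl⟩
    exact ⟨hu, h⟩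

/-- A local change of sheet extends to the whole universal cover. -/
theorem preservesFiberAt_of_eventually [T2Space S] {g : SL(2, ℝ)} {z : X.cover}
    (h : ∀ᶠ u in 𝓝 z, X.PreservesFiberAt g u) (u : X.cover) : X.PreservesFiberAt g u := by
  set T : Set X.cover := {u | ∀ᶠ v in 𝓝 u, X.PreservesFiberAt g v} with hT
  have hsub : T ⊆ {u | X.PreservesFiberAt g u} := fun u hu => hu.self_of_nhds
  -- At a limit point `u`, a local change of sheet `g'` with the same value as `g` there agrees with
  -- `g` near some `u'` in `T`, because `proj` is injective near `g • u`. Two common values make the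
  -- isometries equal.
  have hclosed : IsClosed T := by
    refine isClosed_of_closure_subset fun u hu => ?_
    obtain ⟨hgu, hpu⟩ := (isClosed_preservesFiberAt g).closure_subset_iff.2 hsub hu
    obtain ⟨g', hg'u, hg'⟩ := X.metric_descends u ⟨g • (u : ℍ), hgu⟩ hpu.symm
    obtain ⟨U, hUo, hUz, hUinj⟩ := X.exists_isOpen_injOn_proj ⟨g • (u : ℍ), hgu⟩
    have hg'mem : g' • (u : ℍ) ∈ X.cover := by rw [hg'u]; exact hgu
    have heq : (⟨g' • (u : ℍ), hg'mem⟩ : X.cover) = ⟨g • (u : ℍ), hgu⟩ := Subtype.ext hg'u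
    have e1 := eventually_smul_mem hgu (hUo.mem_nhds hUz)
    have e2 := eventually_smul_mem hg'mem (hUo.mem_nhds (heq ▸ hUz))
    obtain ⟨u', hu', hu'T⟩ :=
      mem_closure_iff_nhds.1 hu _ (eventually_eventually_nhds.2 (hg'.and (e1.and e2)))
    have hagree : ∀ᶠ v : X.cover in 𝓝 u', g • (v : ℍ) = g' • (v : ℍ) := by
      filter_upwards [hu', hu'T] with v ⟨⟨hv, hpv⟩, h1, h2⟩ ⟨hv', hpv'⟩
      exact congrArg Subtype.val (hUinj (h1 hv') (h2 hv) (hpv'.trans hpv.symm))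
    obtain ⟨v, hne, hv⟩ := eventually_ne_of_cover X u' hagree
    have hid : ∀ w : ℍ, g • w = g' • w := fun w => by
      have := smul_eq_self_of_two_fixed (g := g'⁻¹ * g) (u := v) (v := u')
        (fun h => hne (Subtype.ext h)) (by rw [mul_smul, hv, inv_smul_smul])
        (by rw [mul_smul, hagree.self_of_nhds, inv_smul_smul]) w
      rw [mul_smul] at this
      exact inv_smul_eq_iff.1 this
    filter_upwards [hg'] with w hw
    exact PreservesFiberAt.congr hw (hid w).symm
  have huniv : T = univ :=
    IsClopen.eq_univ ⟨hclosed, isOpen_setOfPred_eventually_nhds⟩ ⟨z, h⟩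
  exact hsub (huniv ▸ mem_univ u)

/-- The deck group acts transitively on the fibres. -/
theorem exists_deck_smul_eq [T2Space S] {z w : X.cover} (h : X.proj z = X.proj w) :
    ∃ g ∈ X.deck, g • (z : ℍ) = w := by
  obtain ⟨g, hgz, hg⟩ := X.metric_descends z w h
  obtain ⟨g', hgw, hg'⟩ := X.metric_descends w z h.symm
  have hG := preservesFiberAt_of_eventually hg
  have hG' := preservesFiberAt_of_eventually hg'
  -- The composite fixes `z` and preserves fibres, so it fixes a nearby second point and is the
  -- identity. Hence `g` maps the cover onto itself, not merely into it.
  have hinv : ∀ u : ℍ, g' • g • u = u := by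
    obtain ⟨U, hUo, hUz, hUinj⟩ := X.exists_isOpen_injOn_proj z
    have hfix : (g' * g) • (z : ℍ) = z := by rw [mul_smul, hgz, hgw]
    have hmem : (g' * g) • (z : ℍ) ∈ X.cover := by rw [hfix]; exact z.2
    have heq : (⟨(g' * g) • (z : ℍ), hmem⟩ : X.cover) = z := Subtype.ext hfix
    have e1 := eventually_smul_mem hmem (hUo.mem_nhds (by rw [heq]; exact hUz))
    obtain ⟨v, hne, hv1, hv2⟩ := eventually_ne_of_cover X z (e1.and (hUo.mem_nhds hUz))
    intro u
    rw [← mul_smul]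
    refine smul_eq_self_of_two_fixed (u := v) (v := z) (fun h => hne (Subtype.ext h)) ?_ hfix u
    obtain ⟨ha, hpa⟩ := hG v
    obtain ⟨hb, hpb⟩ := hG' ⟨_, ha⟩
    have hb' : (g' * g) • (v : ℍ) ∈ X.cover := by rw [mul_smul]; exact hb
    refine congrArg Subtype.val (hUinj (hv1 hb') hv2 ?_)
    rw [← hpa, ← hpb]
    congr 2
    exact mul_smul _ _ _
  refine ⟨g, ⟨fun u => ⟨fun hu => ?_, fun hu => (hG ⟨u, hu⟩).1⟩,
    fun u hu hgu => (hG ⟨u, hu⟩).2⟩, hgz⟩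
  rw [← hinv u]
  exact (hG' ⟨_, hu⟩).1

variable (X)

/-- The deck group acts cocompactly on the universal cover. -/
theorem exists_isCompact_deck [T2Space S] [CompactSpace S] :
    ∃ C : Set X.cover, IsCompact C ∧ ∀ z : X.cover, ∃ g ∈ X.deck, ∃ w ∈ C, g • (z : ℍ) = w := by
  choose f hf using X.surjective_proj
  choose N hNc hN using fun z : X.cover => exists_compact_mem_nhds z
  obtain ⟨t, -, ht⟩ := isCompact_univ.elim_nhds_subcover (fun s : S => X.proj '' N (f s))
    fun s _ => by
      have := X.isCoveringMap_proj.isOpenMap.image_mem_nhds (hN (f s))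
      rwa [hf] at this
  refine ⟨⋃ s ∈ t, N (f s), t.isCompact_biUnion fun s _ => hNc _, fun z => ?_⟩
  obtain ⟨s, hs, w, hw, hwz⟩ := mem_iUnion₂.1 (ht (mem_univ (X.proj z)))
  obtain ⟨g, hg, hgz⟩ := exists_deck_smul_eq hwz.symm
  exact ⟨g, hg, w, mem_iUnion₂.2 ⟨s, hs, hw⟩, hgz⟩

theorem deck_smul_mem {g : SL(2, ℝ)} (hg : g ∈ X.deck) {z : ℍ} (hz : z ∈ X.cover) :
    g • z ∈ X.cover := (hg.1 z).2 hz

/-- The injectivity radius is positive. -/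
theorem exists_pos_deck_smul_eq_self [T2Space S] [CompactSpace S] :
    ∃ ε > 0, ∀ z ∈ X.cover, ∀ g ∈ X.deck, dist z (g • z) < ε → g • z = z := by
  obtain ⟨C, hC, hCd⟩ := X.exists_isCompact_deck
  choose U hUo hUz hUinj using X.exists_isOpen_injOn_proj
  obtain ⟨ε, hε, hεC⟩ := lebesgue_number_lemma_of_metric hC hUo
    fun z _ => mem_iUnion.2 ⟨z, hUz z⟩
  refine ⟨ε, hε, fun z hz g hg hdist => ?_⟩
  obtain ⟨γ, hγ, w, hw, hγz⟩ := hCd ⟨z, hz⟩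
  obtain ⟨i, hi⟩ := hεC w hw
  have hgz := X.deck_smul_mem hg hz
  have hγgz := X.deck_smul_mem hγ hgz
  -- After moving by `γ`, both points lie in one Lebesgue ball about a point of `C`, on which `proj`
  -- is injective.
  have hmem : (⟨γ • g • z, hγgz⟩ : X.cover) ∈ Metric.ball w ε := by
    rw [Metric.mem_ball, Subtype.dist_eq, ← hγz]
    rw [dist_smul, dist_comm]
    exact hdist
  have hγz' := X.deck_smul_mem hγ hz
  have hw' : w = ⟨γ • z, hγz'⟩ := Subtype.ext hγz.symm
  have := hUinj i (hi hmem) (hi (Metric.mem_ball_self hε)) (by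
    rw [hγ.2 _ hgz, hg.2 _ hz, hw', hγ.2 _ hz])
  have := congrArg Subtype.val this
  rw [← hγz] at this
  exact MulAction.injective γ this

/-- A deck transformation with a fixed point is trivial. -/
theorem deck_smul_eq_self [T2Space S] [CompactSpace S] {g : SL(2, ℝ)} (hg : g ∈ X.deck) {z : ℍ}
    (hz : z ∈ X.cover) (hgz : g • z = z) (u : ℍ) : g • u = u := by
  obtain ⟨ε, hε, h⟩ := X.exists_pos_deck_smul_eq_self
  -- A second point within `ε / 2` of the fixed point is displaced by less than `ε`, hence is fixed
  -- too.
  obtain ⟨v, hne, hv⟩ := eventually_ne_of_cover X ⟨z, hz⟩ (Metric.ball_mem_nhds _ (half_pos hε))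
  rw [Subtype.dist_eq] at hv
  refine smul_eq_self_of_two_fixed (fun h => hne (Subtype.ext h)) (h v v.2 g hg ?_) hgz u
  calc dist (v : ℍ) (g • (v : ℍ)) ≤ dist (v : ℍ) z + dist (g • z) (g • (v : ℍ)) := by
        rw [hgz]; exact dist_triangle _ _ _
    _ = dist (v : ℍ) z + dist (v : ℍ) z := by rw [dist_smul, dist_comm z]
    _ < ε := by
      have : dist (v : ℍ) z < ε / 2 := hv
      linarith

end HyperbolicSurface

namespace HypPlane

/-! ### Intervals of the circle at infinity -/

theorem isClosed_interval (p q : OnePoint ℝ) : IsClosed {y | y = p ∨ y = q ∨ Between p y q} := by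
  have hcoe : ∀ r : ℝ, bdryCoord (r : OnePoint ℝ) = (r : WithTop ℝ) := fun _ => rfl
  have hinf : bdryCoord ∞ = ⊤ := rfl
  induction p using OnePoint.rec with
  | infty =>
    rw [OnePoint.isClosed_iff_of_mem (by simp)]
    induction q using OnePoint.rec with
    | infty => simp [Between, hinf]
    | coe b =>
      convert! isClosed_Iic (a := b) using 1
      ext r
      simp [Between, hcoe, hinf, le_iff_eq_or_lt]
  | coe a =>
    induction q using OnePoint.rec with
    | infty =>
      rw [OnePoint.isClosed_iff_of_mem (by simp)]
      convert! isClosed_Ici (a := a) using 1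
      ext r
      simp [Between, hcoe, hinf, le_iff_eq_or_lt, eq_comm]
    | coe b =>
      rcases le_or_gt a b with hab | hab
      · convert! (OnePoint.isClosed_image_coe (X := ℝ)).2
          ⟨isClosed_Icc (a := a) (b := b), isCompact_Icc⟩ using 1
        ext y
        induction y using OnePoint.rec with
        | infty => simp [Between, hcoe, hinf, hab]
        | coe r =>
          simp only [Between, hcoe, mem_ofPred_eq, WithTop.coe_lt_coe, mem_image, mem_Icc,
            OnePoint.coe_eq_coe, exists_eq_right]
          grind
      · rw [OnePoint.isClosed_iff_of_mem (by simp [Between, hcoe, hinf, hab])]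
        convert! (isClosed_Iic (a := b)).union (isClosed_Ici (a := a)) using 1
        ext r
        simp only [Between, hcoe, mem_ofPred_eq, WithTop.coe_lt_coe, mem_preimage, mem_union,
          mem_Iic, mem_Ici, OnePoint.coe_eq_coe]
        grind

/-- In a coordinate with `x` at infinity, a closed set of the circle that misses `x` is compact. -/
theorem isCompact_coords {Z : Set (OnePoint ℝ)} (hZ : IsClosed Z) (k : SL(2, ℝ))
    (hk : k • (∞ : OnePoint ℝ) ∉ Z) : IsCompact {r : ℝ | k • (r : OnePoint ℝ) ∈ Z} :=
  ((OnePoint.isClosed_iff_of_notMem (s := (fun p => k • p) ⁻¹' Z) hk).1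
    (hZ.preimage (continuous_const_smul k))).2

end HypPlane

namespace HyperbolicSurface

variable {S : Type*} [TopologicalSpace S] (X : HyperbolicSurface S)

/-! ### The space of geodesics -/

theorem coe_deck_smul (g : X.deck) (x : X.idealBoundary) :
    ((g • x : X.idealBoundary) : OnePoint ℝ) = (g : SL(2, ℝ)) • (x : OnePoint ℝ) := rfl

theorem deck_smul_val (g : X.deck) (e : X.Geodesics) : (g • e).1 = e.1.map (g • ·) := rfl

noncomputable instance : MulAction X.deck X.Geodesics where
  one_smul e := Subtype.ext (by
    rw [deck_smul_val]
    simp)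
  mul_smul g h e := Subtype.ext (by
    rw [deck_smul_val, deck_smul_val, deck_smul_val, Sym2.map_map]
    congr 1
    funext x
    exact mul_smul g h x)

instance : ContinuousConstSMul X.deck X.idealBoundary where
  continuous_const_smul g :=
    ((continuous_const_smul (g : SL(2, ℝ))).comp continuous_subtype_val).subtype_mk _

theorem continuous_geodesic : Continuous X.geodesic := continuous_coinduced_rng

theorem exists_geodesic_eq (e : X.Geodesics) : ∃ p, X.geodesic p = e := by
  obtain ⟨e, he⟩ := e
  induction e using Sym2.ind with
  | _ a b => exact ⟨⟨(a, b), by simpa using he⟩, rfl⟩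

instance : ContinuousConstSMul X.deck X.Geodesics where
  continuous_const_smul g := by
    rw [continuous_coinduced_dom]
    have : (fun e : X.Geodesics => g • e) ∘ X.geodesic = X.geodesic ∘
        fun p : {p : X.idealBoundary × X.idealBoundary // p.1 ≠ p.2} =>
          (⟨(g • p.1.1, g • p.1.2), fun h => p.2 (MulAction.injective g h)⟩ :
            {p : X.idealBoundary × X.idealBoundary // p.1 ≠ p.2}) := rfl
    rw [this]
    refine X.continuous_geodesic.comp (Continuous.subtype_mk ?_ _)
    exact ((continuous_fst.comp continuous_subtype_val).const_smul g).prodMk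
      ((continuous_snd.comp continuous_subtype_val).const_smul g)

theorem isClosed_idealBoundary : IsClosed X.idealBoundary :=
  isClosed_closure.preimage continuous_bdryToSphere

/-- Closedness of the ideal boundary lets compactness be checked on pairs of points of the whole
circle. -/
theorem exists_isCompact_geodesics {K : Set (OnePoint ℝ × OnePoint ℝ)} (hK : IsCompact K)
    (hne : ∀ p ∈ K, p.1 ≠ p.2) : ∃ K' : Set X.Geodesics, IsCompact K' ∧
      ∀ e : X.Geodesics, ∀ a b : X.idealBoundary, e.1 = s(a, b) →
        ((a, b) : OnePoint ℝ × OnePoint ℝ) ∈ K → e ∈ K' := by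
  set j : {p : X.idealBoundary × X.idealBoundary // p.1 ≠ p.2} → OnePoint ℝ × OnePoint ℝ :=
    fun p => (p.1.1, p.1.2) with hj
  have hind : IsInducing j :=
    (IsInducing.subtypeVal.prodMap IsInducing.subtypeVal).comp IsInducing.subtypeVal
  refine ⟨X.geodesic '' (j ⁻¹' K), ?_, ?_⟩
  · refine IsCompact.image ?_ X.continuous_geodesic
    rw [hind.isCompact_iff]
    have : j '' (j ⁻¹' K) = K ∩ X.idealBoundary ×ˢ X.idealBoundary := by
      ext ⟨a, b⟩
      constructor
      · rintro ⟨p, hp, hpe⟩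
        rw [← hpe]
        exact ⟨hp, p.1.1.2, p.1.2.2⟩
      · rintro ⟨hp, ha, hb⟩
        exact ⟨⟨(⟨a, ha⟩, ⟨b, hb⟩), fun h => hne _ hp (congrArg Subtype.val h)⟩, hp, rfl⟩
    rw [this]
    exact hK.inter_right (X.isClosed_idealBoundary.prod X.isClosed_idealBoundary)
  · intro e a b he hab
    exact ⟨⟨(a, b), fun h => hne _ hab (congrArg Subtype.val h)⟩, hab, Subtype.ext he.symm⟩

/-- The geodesics joining `x` to a point of `Y`. -/
def spike (x : X.idealBoundary) (Y : Set X.idealBoundary) : Set X.Geodesics :=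
  {e | ∃ y ∈ Y, e.1 = s(x, y)}

variable {X}

theorem isClosed_spike (x : X.idealBoundary) {Y : Set X.idealBoundary} (hY : IsClosed Y) :
    IsClosed (X.spike x Y) := by
  rw [← isOpen_compl_iff]
  refine isOpen_coinduced.2 ?_
  rw [preimage_compl, isOpen_compl_iff]
  have h1 : Continuous fun p : {p : X.idealBoundary × X.idealBoundary // p.1 ≠ p.2} => p.1.1 :=
    continuous_fst.comp continuous_subtype_val
  have h2 : Continuous fun p : {p : X.idealBoundary × X.idealBoundary // p.1 ≠ p.2} => p.1.2 :=
    continuous_snd.comp continuous_subtype_val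
  convert! (((isClosed_singleton (x := x)).preimage h1).inter (hY.preimage h2)).union
    (((isClosed_singleton (x := x)).preimage h2).inter (hY.preimage h1)) using 1
  ext ⟨⟨a, b⟩, hab⟩
  constructor
  · rintro ⟨y, hy, h⟩
    rcases Sym2.eq_iff.1 h with ⟨h1, h2⟩ | ⟨h1, h2⟩
    · exact Or.inl ⟨h1, (congrArg (· ∈ Y) h2).mpr hy⟩
    · exact Or.inr ⟨h2, (congrArg (· ∈ Y) h1).mpr hy⟩
  · rintro (⟨h1, h2⟩ | ⟨h1, h2⟩)
    · exact ⟨b, h2, Sym2.eq_iff.2 (Or.inl ⟨h1, rfl⟩)⟩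
    · exact ⟨a, h2, Sym2.eq_iff.2 (Or.inr ⟨rfl, h1⟩)⟩

theorem spike_singleton {x y : X.idealBoundary} {e : X.Geodesics} (he : e.1 = s(x, y)) :
    X.spike x {y} = {e} := by
  ext e'
  simp only [spike, mem_singleton_iff, exists_eq_left, mem_ofPred_eq, ← he]
  exact ⟨fun h => Subtype.ext h, fun h => congrArg Subtype.val h⟩

theorem isClosed_closedInterval (y₁ y₂ : X.idealBoundary) :
    IsClosed (X.closedInterval y₁ y₂) := by
  convert! (isClosed_interval (y₁ : OnePoint ℝ) y₂).preimage
    (continuous_subtype_val (p := (· ∈ X.idealBoundary))) using 1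
  ext y
  simp [closedInterval, Subtype.ext_iff]

/-! ### Null sets of geodesic currents -/

/-- A set with infinitely many almost disjoint translates in a compact set is null. -/
theorem IsGeodesicCurrent.measure_eq_zero {c : Measure X.Geodesics} (hc : X.IsGeodesicCurrent c)
    {E K : Set X.Geodesics} (hE : MeasurableSet E) (hK : IsCompact K) (g : ℕ → X.deck)
    (hgK : ∀ n, ∀ e ∈ E, g n • e ∈ K)
    (hdisj : ∀ m n, m ≠ n → c {e | (g m)⁻¹ • e ∈ E ∧ (g n)⁻¹ • e ∈ E} = 0) : c E = 0 := by
  have := hc.locallyFinite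
  have := hc.invariant
  have hmeas : ∀ n, MeasurableSet ((fun e : X.Geodesics => (g n)⁻¹ • e) ⁻¹' E) := fun n =>
    (continuous_const_smul (g n)⁻¹).measurable hE
  have hEn : ∀ n, c ((fun e : X.Geodesics => (g n)⁻¹ • e) ⁻¹' E) = c E := fun n =>
    measure_preimage_smul c _ _
  have hunion := measure_iUnion₀ (μ := c)
    (f := fun n => (fun e : X.Geodesics => (g n)⁻¹ • e) ⁻¹' E)
    (fun m n hmn => hdisj m n hmn) (fun n => (hmeas n).nullMeasurableSet)
  have hsub : (⋃ n, (fun e : X.Geodesics => (g n)⁻¹ • e) ⁻¹' E) ⊆ K := by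
    refine iUnion_subset fun n e he => ?_
    have := hgK n _ he
    rwa [smul_inv_smul] at this
  have hlt := (measure_mono hsub).trans_lt (hK.measure_lt_top (μ := c))
  by_contra h0
  rw [hunion] at hlt
  simp only [hEn] at hlt
  rw [ENNReal.tsum_const_eq_top_of_ne_zero h0] at hlt
  exact lt_irrefl _ hlt

theorem IsGeodesicCurrent.measure_singleton_smul {c : Measure X.Geodesics}
    (hc : X.IsGeodesicCurrent c) (g : X.deck) (e : X.Geodesics) : c {g • e} = c {e} := by
  have := hc.invariant
  have hE : MeasurableSet ({e} : Set X.Geodesics) := by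
    obtain ⟨p, rfl⟩ := X.exists_geodesic_eq e
    rw [← spike_singleton (x := p.1.1) (y := p.1.2) rfl]
    exact (isClosed_spike _ isClosed_singleton).measurableSet
  rw [← measure_preimage_smul_of_nullMeasurableSet (μ := c) hE.nullMeasurableSet g⁻¹]
  congr 1
  ext e'
  simp [inv_smul_eq_iff]

end HyperbolicSurface

namespace HypPlane

/-! ### Hyperbolic elements -/

theorem coe_dilation_smul (t : ℝ) (z : ℍ) : ((dilation t • z : ℍ) : ℂ) = (Real.exp t : ℝ) * z := by
  rw [coe_smul_of_lower_left_eq_zero (by simp [dilation])]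
  have h : Real.exp (t / 2) ^ 2 = Real.exp t := by
    rw [← Real.exp_nat_mul]; congr 1; push_cast; ring
  simp only [dilation, Matrix.of_apply, Matrix.cons_val', Matrix.cons_val_zero,
    Matrix.cons_val_one, Matrix.cons_val_fin_one, h, mul_zero, Complex.ofReal_zero, add_zero]

theorem dilation_mul_neg (t : ℝ) : dilation t * dilation (-t) = 1 := by
  apply Subtype.ext
  rw [Matrix.SpecialLinearGroup.coe_mul, Matrix.SpecialLinearGroup.coe_one]
  simp only [dilation, Matrix.mul_fin_two, ← Real.exp_add, Matrix.one_fin_two]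
  simp [neg_div]

theorem dilation_pow_smul_coe (T : ℝ) (n : ℕ) (r : ℝ) :
    dilation T ^ n • (r : OnePoint ℝ) = ((Real.exp T ^ n * r : ℝ) : OnePoint ℝ) := by
  induction n with
  | zero => simp
  | succ n ih => rw [pow_succ', mul_smul, ih, dilation_smul_coe, pow_succ', mul_assoc]

theorem dilation_pow_smul_upper (T : ℝ) (n : ℕ) (z : ℍ) :
    ((dilation T ^ n • z : ℍ) : ℂ) = (Real.exp T ^ n : ℝ) * z := by
  induction n with
  | zero => simp
  | succ n ih => rw [pow_succ', mul_smul, coe_dilation_smul, ih, pow_succ']; push_cast; ring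

/-- An element fixing `∞` that is not parabolic is conjugate to a dilation by a translation. -/
theorem exists_translation_conj_dilation {g : SL(2, ℝ)} (h : g 1 0 = 0) (ha : g 0 0 ^ 2 ≠ 1) :
    ∃ r T : ℝ, T ≠ 0 ∧
      (∀ z : ℍ, g • translation r • z = translation r • dilation T • z) ∧
      ∀ p : OnePoint ℝ, g • translation r • p = translation r • dilation T • p := by
  have hdet := det_eq_one g
  rw [h, mul_zero, sub_zero] at hdet
  have h0 : g 0 0 ≠ 0 := by rintro h0; rw [h0] at hdet; simp at hdet
  have hpos : 0 < g 0 0 ^ 2 := by positivity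
  have hr : 1 - g 0 0 ^ 2 ≠ 0 := fun h => ha (by linarith)
  -- The finite fixed point of the affine map by which `g` acts.
  set r := g 0 0 * g 0 1 / (1 - g 0 0 ^ 2) with hrdef
  have hreq : g 0 0 ^ 2 * r + g 0 0 * g 0 1 = r := by
    rw [hrdef]; field_simp; ring
  refine ⟨r, Real.log (g 0 0 ^ 2), ?_, fun z => ?_, fun p => ?_⟩
  · rw [Ne, Real.log_eq_zero]
    rintro (h1 | h1 | h1)
    · exact hpos.ne' h1
    · exact ha h1
    · linarith
  · apply UpperHalfPlane.ext
    rw [coe_smul_of_lower_left_eq_zero h, translation_smul, translation_smul, coe_dilation_smul,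
      Real.exp_log hpos]
    have : (((g 0 0 ^ 2 * r + g 0 0 * g 0 1 : ℝ)) : ℂ) = r := congrArg _ hreq
    push_cast at this ⊢
    linear_combination this
  · induction p using OnePoint.rec with
    | infty =>
      rw [translation_smul_infty, dilation_smul_infty, translation_smul_infty, smul_infty, if_pos h]
    | coe s =>
      rw [translation_smul_coe, dilation_smul_coe, translation_smul_coe,
        smul_coe_of_lower_left_eq_zero h, Real.exp_log hpos]
      congr 1
      linear_combination hreq

/-- An orientation-preserving isometry exchanging the ends of a geodesic has a fixed point on it. -/
theorem exists_smul_vert_eq_of_swap {g : SL(2, ℝ)}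
    (h1 : g • (∞ : OnePoint ℝ) = ((0 : ℝ) : OnePoint ℝ))
    (h2 : g • ((0 : ℝ) : OnePoint ℝ) = ∞) : ∃ t, g • vert t = vert t := by
  have hd : g 1 1 = 0 := by
    rw [smul_coe, mul_zero, zero_add] at h2
    by_contra hd
    rw [if_neg hd] at h2
    exact OnePoint.coe_ne_infty _ h2
  have hdet := det_eq_one g
  rw [hd, mul_zero, zero_sub] at hdet
  have hc : g 1 0 ≠ 0 := by rintro h0; rw [h0] at hdet; simp at hdet
  have ha : g 0 0 = 0 := by
    rw [smul_infty, if_neg hc, OnePoint.coe_eq_coe, div_eq_zero_iff] at h1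
    exact h1.resolve_right hc
  have hsq : Real.exp (-Real.log |g 1 0|) * Real.exp (-Real.log |g 1 0|) * g 1 0 = -g 0 1 := by
    rw [Real.exp_neg, Real.exp_log (abs_pos.2 hc), ← mul_inv, abs_mul_abs_self]
    field_simp
    linarith
  -- With zero diagonal and determinant one, `g` acts by `z ↦ -1 / (c² z)` for `c = g 1 0`, which
  -- fixes `I / |c|`.
  refine ⟨-Real.log |g 1 0|, UpperHalfPlane.ext ?_⟩
  have hc' : (g 1 0 : ℂ) ≠ 0 := by exact_mod_cast hc
  have hsq' := congrArg ((↑) : ℝ → ℂ) hsq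
  rw [smul_upper_coe, coe_vert, hd, ha, Complex.ofReal_zero, zero_mul, zero_add, add_zero,
    div_eq_iff (mul_ne_zero hc' (mul_ne_zero
      (Complex.ofReal_ne_zero.2 (Real.exp_pos _).ne') Complex.I_ne_zero))]
  rw [Complex.ofReal_mul, Complex.ofReal_mul, Complex.ofReal_neg] at hsq'
  linear_combination hsq' -
    Real.exp (-Real.log |g 1 0|) * Real.exp (-Real.log |g 1 0|) * g 1 0 * Complex.I_sq

end HypPlane

namespace HyperbolicSurface

variable {S : Type*} [TopologicalSpace S] {X : HyperbolicSurface S}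

/-! ### Stabilizers of ideal points -/

theorem smul_vert_mem_cover {k : SL(2, ℝ)} (hx : k • (∞ : OnePoint ℝ) ∈ X.idealBoundary)
    (hy : k • ((0 : ℝ) : OnePoint ℝ) ∈ X.idealBoundary) (t : ℝ) : k • vert t ∈ X.cover :=
  smul_vert_mem X.isClosed_cover X.convex_cover hx hy t

/-- The axis of a deck transformation projects to a closed geodesic. -/
theorem projectsToClosed_of_axis {k : SL(2, ℝ)} {x y : X.idealBoundary}
    (hx : k • (∞ : OnePoint ℝ) = x) (hy : k • ((0 : ℝ) : OnePoint ℝ) = y) {h : SL(2, ℝ)}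
    (hh : h ∈ X.deck) {T : ℝ} (hT : T ≠ 0) (hax : ∀ t, h • k • vert t = k • vert (t + T))
    {e : X.Geodesics} (he : e.1 = s(x, y)) : X.ProjectsToClosed e := by
  have hmem := smul_vert_mem_cover (X := X) (hx ▸ x.2) (hy ▸ y.2)
  have hper : Function.Periodic (X.proj ∘ fun t => (⟨k • vert t, hmem t⟩ : X.cover)) T := by
    intro t
    have hm := X.deck_smul_mem hh (hmem t)
    simp only [Function.comp]
    rw [← hh.2 _ (hmem t) hm]
    congr 2
    exact (hax t).symm
  -- The parametrised geodesic runs from `y` to `x`. The absolute value makes the period positive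
  -- whichever way `h` translates.
  refine ⟨fun t => ⟨k • vert t, hmem t⟩, ?_, ⟨y, x, he.trans Sym2.eq_swap, ?_, ?_⟩, |T|,
    abs_pos.2 hT, ?_⟩
  · exact Isometry.of_dist_eq fun s t => by
      rw [Subtype.dist_eq, dist_smul, isometry_vert.dist_eq]
  · rw [← hy]
    exact tendsto_toSphere_smul k tendsto_toSphere_vert_atBot
  · rw [← hx]
    exact tendsto_toSphere_smul k tendsto_toSphere_vert_atTop
  · rcases abs_choice T with h1 | h1 <;> rw [h1]
    · exact hper
    · exact hper.neg

/-- A deck transformation exchanging two ideal points is trivial. -/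
theorem deck_smul_eq_self_of_swap [T2Space S] [CompactSpace S] {h : SL(2, ℝ)} (hh : h ∈ X.deck)
    {x y : X.idealBoundary} (hxy : x ≠ y) (h1 : h • (x : OnePoint ℝ) = y)
    (h2 : h • (y : OnePoint ℝ) = x) (z : ℍ) : h • z = z := by
  obtain ⟨k, hkx, hky⟩ := exists_smul_infty_smul_zero (x := (x : OnePoint ℝ)) (y := y)
    fun h => hxy (Subtype.ext h)
  obtain ⟨t, ht⟩ := exists_smul_vert_eq_of_swap (g := k⁻¹ * h * k)
    (by rw [mul_smul, mul_smul, hkx, h1, ← hky, inv_smul_smul])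
    (by rw [mul_smul, mul_smul, hky, h2, ← hkx, inv_smul_smul])
  rw [mul_smul, mul_smul, inv_smul_eq_iff] at ht
  exact X.deck_smul_eq_self hh (smul_vert_mem_cover (hkx ▸ x.2) (hky ▸ y.2) t) ht z

theorem exists_ray (x : X.idealBoundary) : ∃ k : SL(2, ℝ), k • (∞ : OnePoint ℝ) = x ∧
    ∀ t, 0 ≤ t → k • vert t ∈ X.cover := by
  obtain ⟨z, hz⟩ := X.interior_nonempty
  obtain ⟨k, hkI, hk⟩ := exists_smul_I_smul_infty (x : OnePoint ℝ) z
  exact ⟨k, hk, fun t ht => smul_vert_mem_of_nonneg X.isClosed_cover X.convex_cover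
    (hkI ▸ interior_subset hz) (hk ▸ x.2) ht⟩

/-- A nontrivial deck transformation fixing an ideal point is hyperbolic. -/
theorem exists_conj_dilation_of_deck [T2Space S] [CompactSpace S] {h : SL(2, ℝ)} (hh : h ∈ X.deck)
    {x : X.idealBoundary} (hx : h • (x : OnePoint ℝ) = x) {u : ℍ} (hu : h • u ≠ u) :
    ∃ (k : SL(2, ℝ)) (T : ℝ), k • (∞ : OnePoint ℝ) = x ∧ T ≠ 0 ∧
      (∀ z : ℍ, h • k • z = k • dilation T • z) ∧
      ∀ p : OnePoint ℝ, h • k • p = k • dilation T • p := by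
  obtain ⟨k, hk, hray⟩ := exists_ray x
  set g := k⁻¹ * h * k with hg
  have hgz : ∀ z : ℍ, h • k • z = k • g • z := fun z => by
    rw [hg, mul_smul, mul_smul, smul_inv_smul]
  have hgp : ∀ p : OnePoint ℝ, h • k • p = k • g • p := fun z => by
    rw [hg, mul_smul, mul_smul, smul_inv_smul]
  have hg0 : g 1 0 = 0 := by
    refine lower_left_eq_zero_of_smul_infty ?_
    rw [hg, mul_smul, mul_smul, hk, hx, ← hk, inv_smul_smul]
  -- In this case `g` is a Euclidean translation by `β`. At height `exp t` it moves points by at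
  -- most `|β| / exp t`, eventually below the injectivity radius.
  by_cases ha : g 0 0 ^ 2 = 1
  · exfalso
    obtain ⟨ε, hε, hinj⟩ := X.exists_pos_deck_smul_eq_self
    have hcoe : ∀ z : ℍ, ((g • z : ℍ) : ℂ) = z + (g 0 0 * g 0 1 : ℝ) := fun z => by
      rw [coe_smul_of_lower_left_eq_zero hg0, ha, Complex.ofReal_one, one_mul]
    set β := g 0 0 * g 0 1 with hβ
    have hdist : ∀ t, dist (vert t) (g • vert t) ≤ |β| / Real.exp t := fun t => by
      refine (UpperHalfPlane.dist_le_dist_coe_div_sqrt _ _).trans_eq ?_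
      have him : (g • vert t).im = Real.exp t := by
        have := congrArg Complex.im (hcoe (vert t))
        simpa [vert] using this
      have him' : (vert t).im = Real.exp t := rfl
      rw [him, him', Real.sqrt_mul_self (Real.exp_pos t).le, hcoe, dist_self_add_right,
        Complex.norm_real, Real.norm_eq_abs]
    have hlim : Tendsto (fun t => |β| / Real.exp t) atTop (𝓝 0) :=
      Real.tendsto_exp_atTop.const_div_atTop _
    obtain ⟨t, ht, ht0⟩ := ((hlim.eventually_lt_const hε).and (eventually_ge_atTop 0)).exists
    have hfix : h • k • vert t = k • vert t := by
      refine hinj _ (hray t ht0) h hh ?_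
      rw [hgz, dist_smul]
      exact (hdist t).trans_lt ht
    exact hu (X.deck_smul_eq_self hh (hray t ht0) hfix u)
  · obtain ⟨r, T, hT, h1, h2⟩ := exists_translation_conj_dilation hg0 ha
    refine ⟨k * translation r, T, by rw [mul_smul, translation_smul_infty, hk], hT, fun z => ?_,
      fun p => ?_⟩
    · rw [mul_smul, hgz, h1, mul_smul]
    · rw [mul_smul, hgp, h2, mul_smul]

/-! ### Spikes are null -/

theorem isClosed_image_ideal {Y : Set X.idealBoundary} (hY : IsClosed Y) :
    IsClosed (Subtype.val '' Y) :=
  X.isClosed_idealBoundary.isClosedEmbedding_subtypeVal.isClosedMap _ hY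

theorem exists_coord {x y : X.idealBoundary} (hne : y ≠ x) {k : SL(2, ℝ)}
    (hk : k • (∞ : OnePoint ℝ) = x) : ∃ r : ℝ, k • (r : OnePoint ℝ) = y := by
  obtain ⟨r, hr⟩ := OnePoint.ne_infty_iff_exists.1
    (fun h => hne (Subtype.ext (by rw [← hk, ← h, smul_inv_smul])) : k⁻¹ • (y : OnePoint ℝ) ≠ ∞)
  exact ⟨r, by rw [hr, smul_inv_smul]⟩

theorem isCompact_coords_ideal {x : X.idealBoundary} {Y : Set X.idealBoundary} (hY : IsClosed Y)
    (hx : x ∉ Y) {k : SL(2, ℝ)} (hk : k • (∞ : OnePoint ℝ) = x) :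
    IsCompact {r : ℝ | k • (r : OnePoint ℝ) ∈ Subtype.val '' Y} := by
  refine isCompact_coords (isClosed_image_ideal hY) k ?_
  rw [hk]
  rintro ⟨y, hy, hyx⟩
  exact hx (Subtype.ext hyx ▸ hy)

/-- This is where closedness of `Y` and `x ∉ Y` enter: seen from `x`, the set `Y` is compact in the
real line. -/
theorem exists_bound_coords {x : X.idealBoundary} {Y : Set X.idealBoundary} (hY : IsClosed Y)
    (hx : x ∉ Y) {k : SL(2, ℝ)} (hk : k • (∞ : OnePoint ℝ) = x) :
    ∃ M, ∀ r : ℝ, k • (r : OnePoint ℝ) ∈ Subtype.val '' Y → |r| ≤ M := by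
  obtain ⟨M, hM⟩ := (isCompact_coords_ideal hY hx hk).isBounded.exists_norm_le
  exact ⟨M, fun r hr => hM r hr⟩

theorem smul_infty_ne_smul_coe (k : SL(2, ℝ)) (r : ℝ) :
    k • (∞ : OnePoint ℝ) ≠ k • (r : OnePoint ℝ) := fun h =>
  OnePoint.infty_ne_coe r (MulAction.injective k h)

theorem smul_val_eq {g : X.deck} {e : X.Geodesics} {x y : X.idealBoundary} (he : e.1 = s(x, y)) :
    (g • e).1 = s(g • x, g • y) := by
  rw [deck_smul_val, he, Sym2.map_mk]

/-- Points of a ray to `x` are returned to a compact set by cocompactness. Moving the base point up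
the ray multiplies the coordinates of `Y` by a factor at most one, so the bound on them persists. -/
theorem exists_translates_in_compact [T2Space S] [CompactSpace S] {x : X.idealBoundary}
    {Y : Set X.idealBoundary} (hY : IsClosed Y) (hx : x ∉ Y) :
    ∃ (g : ℕ → X.deck) (K : Set X.Geodesics), IsCompact K ∧
      (∀ n, ∀ e ∈ X.spike x Y, g n • e ∈ K) ∧
      ∀ m n, (∀ z : ℍ, (g m : SL(2, ℝ)) • z = (g n : SL(2, ℝ)) • z) → m = n := by
  obtain ⟨k, hk, hray⟩ := exists_ray x
  obtain ⟨C, hC, hCd⟩ := X.exists_isCompact_deck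
  obtain ⟨D, hD⟩ := Metric.isBounded_iff.1 hC.isBounded
  obtain ⟨M, hM⟩ := exists_bound_coords hY hx hk
  -- Ray points spaced by more than the diameter bound of `C` cannot be returned to `C` by the same
  -- isometry.
  set D' := |D| + 1 with hD'
  have hD'pos : 0 < D' := by positivity
  have hDD' : D < D' := (le_abs_self D).trans_lt (lt_add_one _)
  have hnonneg : ∀ n : ℕ, 0 ≤ n * D' := fun n => by positivity
  choose g hg w hw hgw using fun n : ℕ => hCd ⟨_, hray _ (hnonneg n)⟩
  obtain ⟨K, hK, hKmem⟩ := X.exists_isCompact_geodesics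
    (isCompact_image_endpoints (hC.image continuous_subtype_val) (isCompact_Icc (a := -M) (b := M)))
    (by rintro _ ⟨⟨m, r⟩, -, rfl⟩; exact smul_infty_ne_smul_coe m r)
  refine ⟨fun n => ⟨g n, hg n⟩, K, hK, ?_, ?_⟩
  · rintro n e ⟨y, hy, he⟩
    refine hKmem _ _ _ (smul_val_eq he) ?_
    obtain ⟨r, hr⟩ := exists_coord (fun h => hx (h ▸ hy) : y ≠ x) hk
    have hrM := hM r ⟨y, hy, hr.symm⟩
    -- The translated frame, based at the returned ray point `w n`; in it the end `y` has coordinate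
    -- `exp (-(n * D')) * r`.
    refine ⟨(g n * k * dilation (n * D'), Real.exp (-(n * D')) * r), ⟨?_, ?_⟩, ?_⟩
    · refine ⟨w n, hw n, ?_⟩
      simp only [mul_smul]
      rw [← vert_zero, dilation_smul_vert, zero_add]
      exact (hgw n).symm
    · rw [mem_Icc, ← abs_le, abs_mul, abs_of_pos (Real.exp_pos _)]
      refine le_trans (mul_le_of_le_one_left (abs_nonneg r) ?_) hrM
      exact Real.exp_le_one_iff.2 (neg_nonpos.2 (hnonneg n))
    · refine Prod.ext ?_ ?_
      · simp only [mul_smul]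
        rw [dilation_smul_infty, hk]
        rfl
      · simp only [mul_smul]
        rw [dilation_smul_coe, ← mul_assoc, ← Real.exp_add, add_neg_cancel, Real.exp_zero, one_mul,
          hr]
        rfl
  · intro m n hmn
    by_contra hne
    have h1 : (1 : ℝ) ≤ |(m : ℝ) - n| := by
      have : (1 : ℤ) ≤ |(m : ℤ) - n| := Int.one_le_abs (by omega)
      exact_mod_cast this
    have h2 : dist (k • vert (m * D')) (k • vert (n * D')) = |(m : ℝ) - n| * D' := by
      rw [dist_smul, isometry_vert.dist_eq, Real.dist_eq, ← sub_mul, abs_mul, abs_of_pos hD'pos]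
    have h3 : dist (k • vert (m * D')) (k • vert (n * D')) ≤ D := by
      rw [← dist_smul (g m)]
      have := hD (hw m) (hw n)
      rwa [Subtype.dist_eq, ← hgw, ← hgw, ← hmn] at this
    rw [h2] at h3
    nlinarith

/-- If no nontrivial deck transformation fixes `x`, then the geodesics ending at `x` are not
atoms. -/
theorem IsGeodesicCurrent.measure_singleton_eq_zero [T2Space S] [CompactSpace S]
    {c : Measure X.Geodesics} (hc : X.IsGeodesicCurrent c) {x y : X.idealBoundary}
    (hstab : ∀ h ∈ X.deck, h • (x : OnePoint ℝ) = x → ∀ z : ℍ, h • z = z) {e : X.Geodesics}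
    (he : e.1 = s(x, y)) : c {e} = 0 := by
  have hxy : x ≠ y := fun h => e.2 (by rw [he, h]; simp)
  have hY : IsClosed ({y} : Set X.idealBoundary) := isClosed_singleton
  obtain ⟨g, K, hK, hgK, hinj⟩ := exists_translates_in_compact hY (mt mem_singleton_iff.1 hxy)
  rw [← spike_singleton he]
  refine hc.measure_eq_zero (isClosed_spike x hY).measurableSet hK g hgK fun m n hmn => ?_
  convert measure_empty (μ := c)
  refine eq_empty_of_forall_notMem fun e' ⟨h1, h2⟩ => hmn (hinj m n fun z => ?_)
  rw [spike_singleton he, mem_singleton_iff] at h1 h2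
  -- So this element either fixes `x` or exchanges `x` and `y`; both make it trivial.
  have hfix : ((g n)⁻¹ * g m) • e = e := by
    rw [mul_smul, inv_smul_eq_iff, ← h1, smul_inv_smul, h1, ← h2, smul_inv_smul]
  have hfix' := congrArg Subtype.val hfix
  rw [smul_val_eq he, he] at hfix'
  have htriv : ((g n : SL(2, ℝ))⁻¹ * g m) • z = z := by
    have hmem := ((g n)⁻¹ * g m).2
    rcases Sym2.eq_iff.1 hfix' with ⟨ha, -⟩ | ⟨ha, hb⟩
    · exact hstab _ hmem (congrArg Subtype.val ha) z
    · exact deck_smul_eq_self_of_swap hmem hxy (congrArg Subtype.val ha)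
        (congrArg Subtype.val hb) z
  rwa [mul_smul, inv_smul_eq_iff] at htriv

/-- Distinct translates have distinct apexes, so they share at most the geodesic joining the two
apexes, which is not an atom. -/
theorem IsGeodesicCurrent.measure_spike_of_trivial_stabilizer [T2Space S] [CompactSpace S]
    {c : Measure X.Geodesics} (hc : X.IsGeodesicCurrent c) {x : X.idealBoundary}
    (hstab : ∀ h ∈ X.deck, h • (x : OnePoint ℝ) = x → ∀ z : ℍ, h • z = z)
    {Y : Set X.idealBoundary} (hY : IsClosed Y) (hx : x ∉ Y) : c (X.spike x Y) = 0 := by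
  obtain ⟨g, K, hK, hgK, hinj⟩ := exists_translates_in_compact hY hx
  refine hc.measure_eq_zero (isClosed_spike x hY).measurableSet hK g hgK fun m n hmn => ?_
  have hval : ∀ e : X.Geodesics, (g m)⁻¹ • e ∈ X.spike x Y ∧ (g n)⁻¹ • e ∈ X.spike x Y →
      e.1 = s(g m • x, g n • x) := by
    rintro e ⟨⟨y, hy, he⟩, ⟨y', hy', he'⟩⟩
    have h1 := smul_val_eq (g := g m) he
    have h2 := smul_val_eq (g := g n) he'
    rw [smul_inv_smul] at h1 h2
    rcases Sym2.eq_iff.1 (h1.symm.trans h2) with ⟨ha, -⟩ | ⟨-, hb⟩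
    · refine absurd (hinj m n fun z => ?_) hmn
      have := hstab _ ((g n)⁻¹ * g m).2
        (congrArg Subtype.val (show ((g n)⁻¹ * g m) • x = x by
          rw [mul_smul, ha, inv_smul_smul])) z
      have hz : ((g n)⁻¹ : SL(2, ℝ)) • (g m : SL(2, ℝ)) • z = z := by
        rw [← mul_smul]; exact this
      exact inv_smul_eq_iff.1 hz
    · rw [h1, hb]
  rcases eq_empty_or_nonempty
    {e | (g m)⁻¹ • e ∈ X.spike x Y ∧ (g n)⁻¹ • e ∈ X.spike x Y} with hem | ⟨e, he⟩
  · rw [hem, measure_empty]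
  · refine measure_mono_null (t := {e}) (fun e' he' => ?_) ?_
    · exact Subtype.ext ((hval e' he').trans (hval e he).symm)
    · obtain ⟨y, -, hy⟩ := he.1
      rw [← hc.measure_singleton_smul (g m)⁻¹ e]
      exact hc.measure_singleton_eq_zero hstab hy

/-- A contraction towards the other fixed point makes the spike disjoint from its translates. -/
theorem IsGeodesicCurrent.measure_spike_of_contraction [T2Space S] [CompactSpace S]
    {c : Measure X.Geodesics} (hc : X.IsGeodesicCurrent c) {x : X.idealBoundary}
    {Y : Set X.idealBoundary} (hY : IsClosed Y) (hx : x ∉ Y)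
    (hclosed : ∀ y ∈ Y, ∀ e : X.Geodesics, e.1 = s(x, y) → ¬ X.ProjectsToClosed e)
    {h : SL(2, ℝ)} (hh : h ∈ X.deck) {k : SL(2, ℝ)} {T : ℝ}
    (hk : k • (∞ : OnePoint ℝ) = x) (hT : T < 0)
    (hz : ∀ z : ℍ, h • k • z = k • dilation T • z)
    (hp : ∀ p : OnePoint ℝ, h • k • p = k • dilation T • p) : c (X.spike x Y) = 0 := by
  have hTexp : Real.exp T < 1 := Real.exp_zero ▸ Real.exp_lt_exp.2 hT
  have hpz : ∀ (n : ℕ) (z : ℍ), h ^ n • k • z = k • dilation T ^ n • z := by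
    intro n z
    induction n with
    | zero => simp
    | succ n ih => rw [pow_succ', mul_smul, ih, hz, pow_succ', mul_smul]
  have hpp : ∀ (n : ℕ) (p : OnePoint ℝ), h ^ n • k • p = k • dilation T ^ n • p := by
    intro n p
    induction n with
    | zero => simp
    | succ n ih => rw [pow_succ', mul_smul, ih, hp, pow_succ', mul_smul]
  have hlim : Tendsto (fun n : ℕ => Real.exp T ^ n) atTop (𝓝 0) :=
    tendsto_pow_atTop_nhds_zero_of_lt_one (Real.exp_pos T).le hTexp
  -- The attracting fixed point is the limit of the orbit `h ^ n • u` of a point of the cover.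
  have hy0 : k • ((0 : ℝ) : OnePoint ℝ) ∈ X.idealBoundary := by
    obtain ⟨u, hu⟩ := X.interior_nonempty
    refine mem_closure_of_tendsto (f := fun n : ℕ => toSphere (k • dilation T ^ n • k⁻¹ • u))
      (b := atTop) ?_ (Eventually.of_forall fun n => ⟨_, ?_, rfl⟩)
    · have hb := bdryToSphere_smul k ((0 : ℝ) : OnePoint ℝ)
      rw [toGL_smul] at hb
      simp only [toSphere_smul k, hb]
      refine ((continuous_smul_sphere _).tendsto _).comp ?_
      have h1 := ((Complex.continuous_ofReal.tendsto 0).comp hlim).mul_const ((k⁻¹ • u : ℍ) : ℂ)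
      have h2 := (OnePoint.continuous_coe.tendsto _).comp h1
      simpa [bdryToSphere, Function.comp_def, toSphere, dilation_pow_smul_upper] using h2
    · rw [← hpz, smul_inv_smul]
      exact X.deck_smul_mem (X.deck.pow_mem hh n) (interior_subset hu)
  -- The geodesic from `x` to this point is the axis of `h`, which projects to a closed geodesic.
  have hy0Y : k • ((0 : ℝ) : OnePoint ℝ) ∉ Subtype.val '' Y := by
    rintro ⟨y, hy, hyk⟩
    have hxy : x ≠ y := fun h => hx (h ▸ hy)
    refine hclosed y hy ⟨s(x, y), by simpa using hxy⟩ rfl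
      (projectsToClosed_of_axis hk hyk.symm hh hT.ne (fun t => ?_) rfl)
    rw [hz, dilation_smul_vert]
  obtain ⟨M, hM⟩ := exists_bound_coords hY hx hk
  obtain ⟨δ, hδ, hδY⟩ : ∃ δ > 0, ∀ r : ℝ, k • (r : OnePoint ℝ) ∈ Subtype.val '' Y → δ ≤ |r| := by
    obtain ⟨δ, hδ, hball⟩ := Metric.isOpen_iff.1
      (isCompact_coords_ideal hY hx hk).isClosed.isOpen_compl 0 hy0Y
    refine ⟨δ, hδ, fun r hr => not_lt.1 fun hlt => hball ?_ hr⟩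
    simpa using hlt
  -- The coordinates of `Y` have absolute value between `δ` and `M`; `h ^ N` brings all of them
  -- below `δ`.
  obtain ⟨N, hN⟩ : ∃ N : ℕ, Real.exp T ^ N * |M| < δ := by
    have := hlim.mul_const |M|
    rw [zero_mul] at this
    exact (this.eventually_lt_const hδ).exists
  set g : ℕ → X.deck := fun n => ⟨h ^ (N * n), X.deck.pow_mem hh _⟩ with hg
  have hgx : ∀ n, ((g n • x : X.idealBoundary) : OnePoint ℝ) = k • ∞ := by
    intro n
    rw [coe_deck_smul, ← hk, hg, hpp]
    congr 1
    induction N * n with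
    | zero => simp
    | succ n ih => rw [pow_succ', mul_smul, ih, dilation_smul_infty]
  have hgy : ∀ n, ∀ y : X.idealBoundary, ∀ r : ℝ, k • (r : OnePoint ℝ) = y →
      ((g n • y : X.idealBoundary) : OnePoint ℝ) =
        k • ((Real.exp T ^ (N * n) * r : ℝ) : OnePoint ℝ) := by
    intro n y r hr
    rw [coe_deck_smul, ← hr, hg, hpp, dilation_pow_smul_coe]
  obtain ⟨K, hK, hKmem⟩ := X.exists_isCompact_geodesics
    (isCompact_image_endpoints (isCompact_singleton (x := k • UpperHalfPlane.I))
      (isCompact_Icc (a := -|M|) (b := |M|)))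
    (by rintro _ ⟨⟨m, r⟩, -, rfl⟩; exact smul_infty_ne_smul_coe m r)
  refine hc.measure_eq_zero (isClosed_spike x hY).measurableSet hK g ?_ ?_
  · rintro n e ⟨y, hy, he⟩
    refine hKmem _ _ _ (smul_val_eq he) ?_
    obtain ⟨r, hr⟩ := exists_coord (fun h => hx (h ▸ hy) : y ≠ x) hk
    have hrM := hM r ⟨y, hy, hr.symm⟩
    refine ⟨(k, Real.exp T ^ (N * n) * r), ⟨rfl, ?_⟩, Prod.ext (hgx n).symm (hgy n y r hr).symm⟩
    rw [mem_Icc, ← abs_le, abs_mul, abs_of_pos (pow_pos (Real.exp_pos _) _)]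
    exact (mul_le_of_le_one_left (abs_nonneg r)
      (pow_le_one₀ (Real.exp_pos T).le hTexp.le)).trans (hrM.trans (le_abs_self M))
  -- All translates share the apex `x`, so a common geodesic has a common second end. Then a
  -- coordinate `r` of `Y` would be another one contracted by at least `exp T ^ N`, against `δ ≤
  -- |r|`.
  · have key : ∀ m n, m < n → ∀ e : X.Geodesics,
        (g m)⁻¹ • e ∈ X.spike x Y → (g n)⁻¹ • e ∉ X.spike x Y := by
      rintro m n hmn e ⟨y, hy, he⟩ ⟨y', hy', he'⟩
      have h1 := smul_val_eq (g := g m) he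
      have h2 := smul_val_eq (g := g n) he'
      rw [smul_inv_smul] at h1 h2
      have hxx : g m • x = g n • x := Subtype.ext ((hgx m).trans (hgx n).symm)
      rw [h1, hxx, Sym2.congr_right] at h2
      obtain ⟨r, hr⟩ := exists_coord (fun h => hx (h ▸ hy) : y ≠ x) hk
      obtain ⟨r', hr'⟩ := exists_coord (fun h => hx (h ▸ hy') : y' ≠ x) hk
      have h3 := (hgy m y r hr).symm.trans ((congrArg Subtype.val h2).trans (hgy n y' r' hr'))
      have h4 := OnePoint.coe_injective (MulAction.injective k h3)
      obtain ⟨j, rfl⟩ := Nat.exists_eq_add_of_lt hmn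
      have h5 : r = Real.exp T ^ (N * j) * (Real.exp T ^ N * r') := by
        refine mul_left_cancel₀ (pow_pos (Real.exp_pos T) (N * m)).ne' (h4.trans ?_)
        ring
      have h6 := hδY r ⟨y, hy, hr.symm⟩
      have h7 := hM r' ⟨y', hy', hr'.symm⟩
      have h8 : |r| ≤ Real.exp T ^ N * |M| := by
        rw [h5, abs_mul, abs_mul, abs_of_pos (pow_pos (Real.exp_pos T) (N * j)),
          abs_of_pos (pow_pos (Real.exp_pos T) N)]
        refine (mul_le_of_le_one_left (by positivity)
          (pow_le_one₀ (Real.exp_pos T).le hTexp.le)).trans ?_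
        exact mul_le_mul_of_nonneg_left (h7.trans (le_abs_self M)) (by positivity)
      linarith
    intro m n hmn
    convert measure_empty (μ := c)
    refine eq_empty_of_forall_notMem fun e ⟨h1, h2⟩ => ?_
    rcases lt_or_gt_of_ne hmn with hlt | hlt
    · exact key m n hlt e h1 h2
    · exact key n m hlt e h2 h1

/-- A closed spike without closed geodesics is null for every geodesic current. -/
theorem IsGeodesicCurrent.measure_spike_eq_zero [T2Space S] [CompactSpace S]
    {c : Measure X.Geodesics} (hc : X.IsGeodesicCurrent c) {x : X.idealBoundary}
    {Y : Set X.idealBoundary} (hY : IsClosed Y) (hx : x ∉ Y)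
    (hclosed : ∀ y ∈ Y, ∀ e : X.Geodesics, e.1 = s(x, y) → ¬ X.ProjectsToClosed e) :
    c (X.spike x Y) = 0 := by
  by_cases hstab : ∀ h ∈ X.deck, h • (x : OnePoint ℝ) = x → ∀ z : ℍ, h • z = z
  · exact hc.measure_spike_of_trivial_stabilizer hstab hY hx
  · push Not at hstab
    obtain ⟨h, hh, hhx, u, hu⟩ := hstab
    obtain ⟨k, T, hk, hT, hz, hp⟩ := exists_conj_dilation_of_deck hh hhx hu
    rcases lt_or_gt_of_ne hT with hT | hT
    · exact hc.measure_spike_of_contraction hY hx hclosed hh hk hT hz hp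
    -- The inverse of `h` contracts towards the second fixed point when `h` expands.
    · refine hc.measure_spike_of_contraction hY hx hclosed (X.deck.inv_mem hh) hk
        (neg_lt_zero.2 hT) (fun z => ?_) (fun p => ?_)
      · rw [inv_smul_eq_iff, hz, ← mul_smul (dilation T), dilation_mul_neg, one_smul]
      · rw [inv_smul_eq_iff, hp, ← mul_smul (dilation T), dilation_mul_neg, one_smul]

end HyperbolicSurface

theorem mainTheorem2 {S : Type*} [TopologicalSpace S] [T2Space S] [CompactSpace S]
    [ConnectedSpace S] (X : HyperbolicSurface S) (x y₁ y₂ : X.idealBoundary)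
    (hx : x ∉ X.closedInterval y₁ y₂)
    (hclosed : ∀ y ∈ X.closedInterval y₁ y₂, ∀ e : X.Geodesics,
      e.1 = s(x, y) → ¬ X.ProjectsToClosed e)
    (c : MeasureTheory.Measure X.Geodesics) (hc : X.IsGeodesicCurrent c) :
    c {e : X.Geodesics | ∃ y ∈ X.openInterval y₁ y₂, e.1 = s(x, y)} = 0 :=
  measure_mono_null (t := X.spike x (X.closedInterval y₁ y₂))
    (fun _ ⟨y, hy, he⟩ => ⟨y, hy.1, he⟩)
    (hc.measure_spike_eq_zero (HyperbolicSurface.isClosed_closedInterval y₁ y₂) hx hclosed)
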